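/- Let $n,N,m,L\in\mathbb{N}$ with $m,L\ge 1$, let $A\in\mathbb{R}^{n\times N}$, and let $\tau,\lambda,B_{\mathrm{out}}>0$, $B_{\mathrm{in}}\in\mathbb{R}$ and $\delta\in(0,1)$. Let $S_{\tau\lambda}$ be the soft-thresholding operator, applied entrywise, where $S_\mu(t)=0$ if $|t|\le\mu$ and $S_\mu(t)=t-\mu\,\mathrm{sign}(t)$ otherwise. For an orthogonal matrix $\Phi\in O(N)$ and $y\in\mathbb{R}^n$ put $$f^1_\Phi(y)=S_{\tau\lambda}\big(\tau (A\Phi)^\top y\big),\qquad f^{l+1}_\Phi(y)=S_{\tau\lambda}\big[f^l_\Phi(y)+\tau (A\Phi)^\top\big(y-A\Phi f^l_\Phi(y)\big)\big]\quad (l\ge 1).$$ Let $\sigma:\mathbb{R}^N\to\mathbb{R}^N$, $\sigma(x)=x$ if $\|x\|_2\le B_{\mathrm{out}}$ and $\sigma(x)=B_{\mathrm{out}}\,x/\|x\|_2$ otherwise, and consider the hypothesis class $$\mathcal{H}_2^L=\{\,y\mapsto\sigma(\Psi f_\Phi^L(y)) : \Psi,\Phi\in O(N)\,\}.$$ Let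 $\mathcal{D}$ be a probability distribution on $\mathbb{R}^N$ such that $\|x\|_2\le B_{\mathrm{in}}$ for $\mathcal{D}$-almost every $x$. Let $x_1,\dots,x_m$ be i.i.d. samples from $\mathcal{D}$, let $y_j=Ax_j$, and let $Y=(y_1|\dots|y_m)\in\mathbb{R}^{n\times m}$. For $h:\mathbb{R}^n\to\mathbb{R}^N$ put $$\mathcal{L}(h)=\mathbb{E}_{x\sim\mathcal{D}}\|h(Ax)-x\|_2,\qquad \hat{\mathcal{L}}(h)=\frac1m\sum_{j=1}^m\|h(y_j)-x_j\|_2 .$$ Writing $a=\|I-\tau A^\top A\|_{2\to2}$, define $$K_L=\tau\|Y\|_F\,a^{L-1}+\tau\|Y\|_F\sum_{l=2}^{L}a^{L-l}\Big(1+2\tau\|A\|_{2\to2}^2\sum_{k=0}^{l-2}a^k\Big),\qquad M_L=\tau\|A\|_{2\to2}\|Y\|_F\sum_{k=0}^{L-1}a^k .$$ Then with probability at least $1-\delta$ over the samples, for all $h\in\mathcal{H}_2^L$ simultaneously, $$\begin{aligned}\mathcal{L}(h)\le\hat{\mathcal{L}}(h)&+8B_{\mathrm{out}}\sqrt{\frac{Nn}{m}}\sqrt{\log\Big(e\Big(1+\frac{8K_L\|A\|_{2\to2}}{\sqrt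 m\,B_{\mathrm{out}}}\Big)\Big)}\\&+8B_{\mathrm{out}}\frac{N}{\sqrt m}\sqrt{\log\Big(e\Big(1+\frac{8M_L}{\sqrt m\,B_{\mathrm{out}}}\Big)\Big)}+4(B_{\mathrm{in}}+B_{\mathrm{out}})\sqrt{\frac{2\log(4/\delta)}{m}} .\end{aligned}$$ -/

import Mathlib

namespace LISTA

noncomputable section

open MeasureTheory

/-- Euclidean space `ℝ^d` with the `ℓ₂`-norm. -/
abbrev Vec (d : ℕ) : Type := EuclideanSpace ℝ (Fin d)

section L2
open scoped Matrix.Norms.L2Operator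

/-- The spectral norm `‖M‖_{2 → 2}` of a real matrix. -/
def opNorm {p q : ℕ} (M : Matrix (Fin p) (Fin q) ℝ) : ℝ := ‖M‖

end L2

section Frob
open scoped Matrix.Norms.Frobenius

/-- The Frobenius norm of a real matrix. -/
def frobNorm {p q : ℕ} (M : Matrix (Fin p) (Fin q) ℝ) : ℝ := ‖M‖

end Frob

/-- Matrix-vector product on Euclidean spaces. -/
def mulE {p q : ℕ} (M : Matrix (Fin p) (Fin q) ℝ) (v : Vec q) : Vec p :=
  WithLp.toLp 2 (M.mulVec v.ofLp)

/-- The shrinkage (soft-thresholding) operator on `ℝ`. -/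
def shrink (lam x : ℝ) : ℝ := if |x| ≤ lam then 0 else x - lam * Real.sign x

/-- The shrinkage operator, applied entrywise. -/
def shrinkVec {d : ℕ} (lam : ℝ) (v : Vec d) : Vec d :=
  WithLp.toLp 2 (fun i => shrink lam (v i))

/-- One soft-thresholding step `z ↦ S_{τλ}[z + τ (AΦ)ᵀ (y - (AΦ) z)]`. -/
def layer {n N : ℕ} (A : Matrix (Fin n) (Fin N) ℝ) (τ lam : ℝ)
    (Φ : Matrix (Fin N) (Fin N) ℝ) (y : Vec n) (z : Vec N) : Vec N :=
  shrinkVec (τ * lam) (z + τ • mulE (A * Φ).transpose (y - mulE (A * Φ) z))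

/-- The output `f_Φ^l(y)` after `l` layers. The iteration starts at `0`, so that the first layer
is `S_{τλ}(τ (AΦ)ᵀ y)`, see `network_one`. -/
def network {n N : ℕ} (A : Matrix (Fin n) (Fin N) ℝ) (τ lam : ℝ)
    (Φ : Matrix (Fin N) (Fin N) ℝ) : ℕ → Vec n → Vec N
  | 0, _ => 0
  | l + 1, y => layer A τ lam Φ y (network A τ lam Φ l y)

theorem network_one {n N : ℕ} (A : Matrix (Fin n) (Fin N) ℝ) (τ lam : ℝ)
    (Φ : Matrix (Fin N) (Fin N) ℝ) (y : Vec n) :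
    network A τ lam Φ 1 y = shrinkVec (τ * lam) (τ • mulE (A * Φ).transpose y) := by
  simp [network, layer, mulE]

/-- The function `σ`: the radial retraction onto the closed `ℓ₂`-ball of radius `Bout`. -/
def clip {N : ℕ} (Bout : ℝ) (x : Vec N) : Vec N :=
  if ‖x‖ ≤ Bout then x else (Bout / ‖x‖) • x

/-- The hypothesis class `H₂^L`: the functions `y ↦ σ(Ψ f_Φ^L(y))` with `Ψ, Φ ∈ O(N)`. -/
def hypothesisClass {n N : ℕ} (A : Matrix (Fin n) (Fin N) ℝ) (τ lam Bout : ℝ) (L : ℕ) :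
    Set (Vec n → Vec N) :=
  {h | ∃ Ψ ∈ Matrix.orthogonalGroup (Fin N) ℝ, ∃ Φ ∈ Matrix.orthogonalGroup (Fin N) ℝ,
    h = fun y => clip Bout (mulE Ψ (network A τ lam Φ L y))}

/-- The loss `ℓ(h, x, y) = ‖h(y) - x‖₂`. -/
def loss {n N : ℕ} (h : Vec n → Vec N) (x : Vec N) (y : Vec n) : ℝ := ‖h y - x‖

/-- The true loss, for a signal `x ∼ D` with measurement `y = A x`. -/
def trueLoss {n N : ℕ} (A : Matrix (Fin n) (Fin N) ℝ) (D : Measure (Vec N))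
    (h : Vec n → Vec N) : ℝ :=
  ∫ x, loss h x (mulE A x) ∂D

/-- The empirical loss on the samples `x₁, …, x_m` with measurements `y_j = A x_j`. -/
def empLoss {n N m : ℕ} (A : Matrix (Fin n) (Fin N) ℝ) (x : Fin m → Vec N)
    (h : Vec n → Vec N) : ℝ :=
  (1 / (m : ℝ)) * ∑ j, loss h (x j) (mulE A (x j))

/-- The matrix `Y ∈ ℝ^{n × m}` whose columns are the measurements `y_j = A x_j`. -/
def measurements {n N m : ℕ} (A : Matrix (Fin n) (Fin N) ℝ) (x : Fin m → Vec N) :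
    Matrix (Fin n) (Fin m) ℝ :=
  Matrix.of fun i j => mulE A (x j) i

/-- `‖I - τ Aᵀ A‖_{2 → 2}`. -/
def contractionFactor {n N : ℕ} (A : Matrix (Fin n) (Fin N) ℝ) (τ : ℝ) : ℝ :=
  opNorm (1 - τ • (A.transpose * A))

/-- The perturbation constant `K_L`, for `L ≥ 1`. The inner sum over `k < l - 1` is
the sum over `0 ≤ k ≤ l - 2`. -/
def constK {n N m : ℕ} (A : Matrix (Fin n) (Fin N) ℝ) (τ : ℝ) (L : ℕ)
    (Y : Matrix (Fin n) (Fin m) ℝ) : ℝ :=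
  τ * frobNorm Y * contractionFactor A τ ^ (L - 1) +
    τ * frobNorm Y * ∑ l ∈ Finset.Icc 2 L, contractionFactor A τ ^ (L - l) *
      (1 + 2 * τ * opNorm A ^ 2 * ∑ k ∈ Finset.range (l - 1), contractionFactor A τ ^ k)

/-- The perturbation constant `M_L`. -/
def constM {n N m : ℕ} (A : Matrix (Fin n) (Fin N) ℝ) (τ : ℝ) (L : ℕ)
    (Y : Matrix (Fin n) (Fin m) ℝ) : ℝ :=
  τ * opNorm A * frobNorm Y * ∑ k ∈ Finset.range L, contractionFactor A τ ^ k

end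

end LISTA

/-! The proof bounds the generalization gap by the empirical Rademacher complexity, which is then
estimated by chaining over nets of the parameters. The loss is first truncated at `Bin + Bout`.
Almost surely this changes nothing, but it makes every loss function bounded everywhere.

Probability: McDiarmid's inequality is applied once, to the largest gap minus twice the empirical
complexity (`measure_maxGap_ge_le`). Symmetrization (`integral_maxGap_le`) makes the mean of this
difference nonpositive, and one sample moves it by at most three times the loss bound. A single tail
event therefore gives a bound in terms of the observed sample, which is why `constK` and `constM`
may depend on `Y`.

Geometry: soft thresholding and the clipping are nonexpansive, so comparing two networks layer by
layer gives a linear recursion for the error, whose solution is `constK`; the size of the output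
gives `constM`. The vector of losses on the sample is thus Lipschitz in the pair `(A * Φ, Ψ)`
(`norm_sampleVec_truncLoss_sub_le`). Since `Φ` enters only through the `n × N` matrix `A * Φ`,
volumetric nets have exponents `N * n` and `N * N`, the source of the two complexity terms. Dyadic
chaining (`rademacher_le_entropy`) sums the entropies over all scales.

Measurability: all suprema are over finite families, with bounds independent of their size. The
result reaches all of `O(N) × O(N)` through a dense sequence and continuity in the parameters. -/

namespace LISTA

open MeasureTheory Module

/-! ### Covering numbers by volume comparison -/

section Nets

/-- A finite nonempty `ε`-separated set in a ball of radius `R` has at most `(1 + 2R/ε)^d` elements. -/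
theorem card_le_of_separated {E : Type*} [NormedAddCommGroup E] [NormedSpace ℝ E]
    [FiniteDimensional ℝ E] (T : Finset E) (hT : T.Nonempty) {R ε : ℝ} (hε : 0 < ε)
    (hR : ∀ x ∈ T, ‖x‖ ≤ R) (hsep : ∀ x ∈ T, ∀ y ∈ T, x ≠ y → ε ≤ dist x y) :
    (T.card : ℝ) ≤ (1 + 2 * R / ε) ^ finrank ℝ E := by
  obtain ⟨x₀, hx₀⟩ := hT
  have hR0 : 0 ≤ R := (norm_nonneg x₀).trans (hR x₀ hx₀)
  let : MeasurableSpace E := borel E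
  have : BorelSpace E := ⟨rfl⟩
  let μ : Measure E := Measure.addHaar
  have hdisj : Set.PairwiseDisjoint (T : Set E) fun x => Metric.ball x (ε / 2) := by
    intro x hx y hy hxy
    apply Metric.ball_disjoint_ball
    have := hsep x hx y hy hxy
    linarith
  -- The disjoint balls of radius `ε / 2` all lie in one ball of radius `R + ε / 2`; comparing Haar
  -- measures cancels the measure of the unit ball.
  have hsub : (⋃ x ∈ T, Metric.ball x (ε / 2)) ⊆ Metric.ball (0 : E) (R + ε / 2) := by
    refine Set.iUnion₂_subset fun x hx => Metric.ball_subset_ball' ?_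
    rw [dist_zero_right]
    linarith [hR x hx]
  have h1 : ∑ x ∈ T, μ (Metric.ball x (ε / 2)) ≤ μ (Metric.ball (0 : E) (R + ε / 2)) := by
    rw [← measure_biUnion_finset hdisj fun _ _ => Metric.isOpen_ball.measurableSet]
    exact measure_mono hsub
  have hε2 : 0 < ε / 2 := by positivity
  have hRε : 0 < R + ε / 2 := by positivity
  simp only [Measure.addHaar_ball_of_pos μ _ hε2, Measure.addHaar_ball_of_pos μ _ hRε,
    Finset.sum_const, nsmul_eq_mul, ← mul_assoc] at h1
  have hpos : μ (Metric.ball (0 : E) 1) ≠ 0 := (Metric.measure_ball_pos μ _ one_pos).ne'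
  have hfin : μ (Metric.ball (0 : E) 1) ≠ ⊤ := measure_ball_lt_top.ne
  rw [ENNReal.mul_le_mul_iff_left hpos hfin] at h1
  have h2 : (T.card : ℝ) * (ε / 2) ^ finrank ℝ E ≤ (R + ε / 2) ^ finrank ℝ E := by
    have := ENNReal.toReal_mono ENNReal.ofReal_ne_top h1
    rwa [ENNReal.toReal_mul, ENNReal.toReal_natCast, ENNReal.toReal_ofReal (by positivity),
      ENNReal.toReal_ofReal (by positivity)] at this
  have h3 : 1 + 2 * R / ε = (R + ε / 2) / (ε / 2) := by field_simp; ring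
  rw [h3, div_pow, le_div_iff₀ (by positivity)]
  exact h2

/-- Internal nets: a nonempty subset of a ball of radius `R` has an `ε`-net consisting of at most
`(1 + 2R/ε)^d` of its own points. -/
theorem exists_net {E : Type*} [NormedAddCommGroup E] [NormedSpace ℝ E]
    [FiniteDimensional ℝ E] (S : Set E) {R ε : ℝ} (hε : 0 < ε)
    (hR : ∀ x ∈ S, ‖x‖ ≤ R) (hS : S.Nonempty) :
    ∃ T : Finset E, (T : Set E) ⊆ S ∧ (T.card : ℝ) ≤ (1 + 2 * R / ε) ^ finrank ℝ E ∧
      ∀ x ∈ S, ∃ t ∈ T, dist x t ≤ ε := by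
  classical
  -- Sizes of `ε`-separated subsets are bounded by the volume estimate. One of largest size is a
  -- net, since an uncovered point could be added to it.
  let C : Set ℕ := {k | ∃ T : Finset E, T.Nonempty ∧ (T : Set E) ⊆ S ∧
    (∀ x ∈ T, ∀ y ∈ T, x ≠ y → ε ≤ dist x y) ∧ T.card = k}
  have hbdd : BddAbove C := by
    refine ⟨⌈(1 + 2 * R / ε) ^ finrank ℝ E⌉₊, ?_⟩
    rintro k ⟨T, hT0, hTS, hsep, rfl⟩
    exact_mod_cast (card_le_of_separated T hT0 hε (fun x hx => hR x (hTS hx)) hsep).trans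
      (Nat.le_ceil _)
  have hne : C.Nonempty := by
    obtain ⟨x, hx⟩ := hS
    refine ⟨1, {x}, by simp, by simpa using hx, ?_, by simp⟩
    intro a ha b hb hab
    simp only [Finset.mem_singleton] at ha hb
    exact absurd (ha.trans hb.symm) hab
  obtain ⟨T, hT0, hTS, hsep, hcard⟩ := Nat.sSup_mem hne hbdd
  refine ⟨T, hTS, card_le_of_separated T hT0 hε (fun x hx => hR x (hTS hx)) hsep, fun x hx => ?_⟩
  by_contra! hcon
  have hxT : x ∉ T := fun h => by
    have := hcon x h
    rw [dist_self] at this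
    linarith
  have : T.card + 1 ∈ C := by
    refine ⟨insert x T, by simp, ?_, ?_, Finset.card_insert_of_notMem hxT⟩
    · rw [Finset.coe_insert]
      exact Set.insert_subset hx hTS
    · intro a ha b hb hab
      rcases Finset.mem_insert.1 ha with rfl | ha' <;> rcases Finset.mem_insert.1 hb with rfl | hb'
      · exact absurd rfl hab
      · exact (hcon b hb').le
      · rw [dist_comm]; exact (hcon a ha').le
      · exact hsep a ha' b hb' hab
  have := le_csSup hbdd this
  omega

/-- Nets with respect to the distance multiplied by a constant `K ≥ 0`. -/
theorem exists_net_scaled {E : Type*} [NormedAddCommGroup E] [NormedSpace ℝ E]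
    [FiniteDimensional ℝ E] (S : Set E) {R ε K : ℝ} (hε : 0 < ε) (hK : 0 ≤ K)
    (hR : ∀ x ∈ S, ‖x‖ ≤ R) (hS : S.Nonempty) :
    ∃ T : Finset E, (T : Set E) ⊆ S ∧ (T.card : ℝ) ≤ (1 + 2 * (K * R) / ε) ^ finrank ℝ E ∧
      ∀ x ∈ S, ∃ t ∈ T, K * dist x t ≤ ε := by
  -- The constant vanishes, for instance, when all measurements are zero. Then one point is a net
  -- and the radius `ε / K` must be avoided.
  rcases hK.eq_or_lt with rfl | hK
  · obtain ⟨x, hx⟩ := hS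
    exact ⟨{x}, by simpa using hx, by simp, fun y _ => ⟨x, by simp, by simpa using hε.le⟩⟩
  · obtain ⟨T, hTS, hcard, hT⟩ := exists_net S (ε := ε / K) (by positivity) hR hS
    refine ⟨T, hTS, ?_, fun x hx => ?_⟩
    · convert hcard using 3
      field_simp
    · obtain ⟨t, ht, hd⟩ := hT x hx
      refine ⟨t, ht, ?_⟩
      rw [mul_comm]
      exact (le_div_iff₀ hK).1 hd

end Nets

end LISTA

namespace LISTA

open MeasureTheory Module

/-! ### Rademacher averages, maximal inequality and chaining -/

noncomputable section Rademacher

/-- The sign `±1` encoded by a Boolean. -/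
def sgn (b : Bool) : ℝ := if b then 1 else -1

/-- The pairing `∑ ε_j v_j` of a vector with a sign pattern. -/
def signPairing {m : ℕ} (ε : Fin m → Bool) (v : Vec m) : ℝ := ∑ j, sgn (ε j) * v j

/-- The average over all sign patterns of length `m`. -/
def signAvg {m : ℕ} (F : (Fin m → Bool) → ℝ) : ℝ := (∑ ε, F ε) / 2 ^ m

/-- The (unnormalised) Rademacher complexity of a family of vectors. -/
def rademacher {m : ℕ} {ι : Type*} (v : ι → Vec m) : ℝ :=
  signAvg fun ε => ⨆ i, signPairing ε (v i)

theorem abs_sgn (b : Bool) : |sgn b| = 1 := by cases b <;> simp [sgn]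

theorem sgn_not (b : Bool) : sgn (!b) = -sgn b := by cases b <;> simp [sgn]

theorem signPairing_add {m : ℕ} (ε : Fin m → Bool) (v w : Vec m) :
    signPairing ε (v + w) = signPairing ε v + signPairing ε w := by
  simp [signPairing, mul_add, Finset.sum_add_distrib]

theorem signAvg_mono {m : ℕ} {F G : (Fin m → Bool) → ℝ} (h : ∀ ε, F ε ≤ G ε) :
    signAvg F ≤ signAvg G := by
  unfold signAvg
  gcongr with ε
  exact h ε

theorem signAvg_add {m : ℕ} (F G : (Fin m → Bool) → ℝ) :
    signAvg (fun ε => F ε + G ε) = signAvg F + signAvg G := by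
  simp [signAvg, Finset.sum_add_distrib, add_div]

theorem signAvg_const_mul {m : ℕ} (c : ℝ) (F : (Fin m → Bool) → ℝ) :
    signAvg (fun ε => c * F ε) = c * signAvg F := by
  simp [signAvg, ← Finset.mul_sum, mul_div_assoc]

theorem signAvg_const {m : ℕ} (c : ℝ) : signAvg (fun _ : Fin m → Bool => c) = c := by
  simp [signAvg]

theorem signAvg_sum {m : ℕ} {ι : Type*} (s : Finset ι) (F : ι → (Fin m → Bool) → ℝ) :
    signAvg (fun ε => ∑ i ∈ s, F i ε) = ∑ i ∈ s, signAvg (F i) := by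
  simp only [signAvg]
  rw [Finset.sum_comm, Finset.sum_div]

theorem signAvg_comp_not {m : ℕ} (F : (Fin m → Bool) → ℝ) :
    signAvg (fun ε => F fun j => !ε j) = signAvg F := by
  have hinv : Function.Involutive fun (ε : Fin m → Bool) j => !ε j := fun ε => by
    funext j; simp
  exact congrArg (· / 2 ^ m) (Equiv.sum_comp hinv.toPerm F)

theorem signPairing_not {m : ℕ} (ε : Fin m → Bool) (v : Vec m) :
    signPairing (fun j => !ε j) v = -signPairing ε v := by
  simp [signPairing, sgn_not]

theorem signAvg_signPairing {m : ℕ} (v : Vec m) : signAvg (fun ε => signPairing ε v) = 0 := by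
  have h := signAvg_comp_not fun ε => signPairing ε v
  simp only [signPairing_not] at h
  have h2 := signAvg_const_mul (-1) fun ε => signPairing ε v
  simp only [neg_one_mul] at h2
  linarith

/-- A Rademacher sum is sub-Gaussian, with variance proxy the squared norm of its coefficients. -/
theorem signAvg_exp_le {m : ℕ} (v : Vec m) (θ : ℝ) :
    signAvg (fun ε => Real.exp (θ * signPairing ε v)) ≤ Real.exp (θ ^ 2 * ‖v‖ ^ 2 / 2) := by
  have h1 : ∀ ε : Fin m → Bool, Real.exp (θ * signPairing ε v)
      = ∏ j, Real.exp (θ * (sgn (ε j) * v j)) := fun ε => by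
    rw [signPairing, Finset.mul_sum, Real.exp_sum]
  have h2 : ∑ ε : Fin m → Bool, ∏ j, Real.exp (θ * (sgn (ε j) * v j))
      = ∏ j, ∑ b : Bool, Real.exp (θ * (sgn b * v j)) := by
    rw [Finset.prod_univ_sum, Fintype.piFinset_univ]
  have h3 : ∀ j, ∑ b : Bool, Real.exp (θ * (sgn b * v j)) = 2 * Real.cosh (θ * v j) := fun j => by
    rw [Real.cosh_eq]
    simp [sgn]
    ring
  simp only [signAvg, h1, h2, h3, Finset.prod_mul_distrib, Finset.prod_const, Finset.card_univ,
    Fintype.card_fin]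
  rw [mul_div_cancel_left₀ _ (by positivity)]
  calc ∏ j, Real.cosh (θ * v j) ≤ ∏ j, Real.exp ((θ * v j) ^ 2 / 2) :=
        Finset.prod_le_prod (fun j _ => (Real.cosh_pos _).le) fun j _ =>
          Real.cosh_le_exp_half_sq _
    _ = Real.exp (θ ^ 2 * ‖v‖ ^ 2 / 2) := by
        rw [← Real.exp_sum, EuclideanSpace.norm_sq_eq, Finset.mul_sum, Finset.sum_div]
        simp [mul_pow]

/-- Optimization of the Chernoff parameter at `θ = √(2 * l) / σ`. For `l = 0` this is not positive,
and `θ = x / σ ^ 2` refutes `0 < x` instead. -/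
theorem le_mul_sqrt_of_forall {x l σ : ℝ} (hl : 0 ≤ l) (hσ : 0 < σ)
    (h : ∀ θ : ℝ, 0 < θ → θ * x ≤ l + θ ^ 2 * σ ^ 2 / 2) : x ≤ σ * √(2 * l) := by
  rcases hl.eq_or_lt with rfl | hl
  · simp only [mul_zero, Real.sqrt_zero]
    by_contra! hx
    have := h (x / σ ^ 2) (by positivity)
    have h2 : x / σ ^ 2 * x = x ^ 2 / σ ^ 2 := by ring
    have h3 : 0 + (x / σ ^ 2) ^ 2 * σ ^ 2 / 2 = x ^ 2 / σ ^ 2 / 2 := by field_simp; ring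
    rw [h2, h3] at this
    have : 0 < x ^ 2 / σ ^ 2 := by positivity
    linarith
  · have hs : 0 < √(2 * l) := by positivity
    have hsq : √(2 * l) ^ 2 = 2 * l := Real.sq_sqrt (by positivity)
    have := h (√(2 * l) / σ) (by positivity)
    have h3 : (√(2 * l) / σ) ^ 2 * σ ^ 2 / 2 = l := by
      rw [div_pow, hsq]; field_simp
    rw [h3, div_mul_eq_mul_div, div_le_iff₀ hσ] at this
    have h4 : √(2 * l) * x ≤ √(2 * l) * (σ * √(2 * l)) := by nlinarith
    exact le_of_mul_le_mul_left h4 hs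

/-- The maximal inequality for finitely many Rademacher sums. -/
theorem rademacher_le_of_card {m : ℕ} {ι : Type*} [Fintype ι] [Nonempty ι] (v : ι → Vec m)
    {σ M : ℝ} (hσ : 0 < σ) (hv : ∀ i, ‖v i‖ ≤ σ) (hM : (Fintype.card ι : ℝ) ≤ M) :
    rademacher v ≤ σ * √(2 * Real.log M) := by
  have hM1 : 1 ≤ M := le_trans (by exact_mod_cast Fintype.card_pos) hM
  refine le_mul_sqrt_of_forall (Real.log_nonneg hM1) hσ fun θ hθ => ?_
  set c := Real.log M + θ ^ 2 * σ ^ 2 / 2 with hc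
  -- The tangent inequality `t + 1 ≤ exp t` at `t = θ * sup - c` replaces Jensen's inequality. The
  -- choice of `c` makes the averaged exponential term at most `1`, leaving exactly `c`.
  have key : ∀ ε : Fin m → Bool, θ * (⨆ i, signPairing ε (v i))
      ≤ Real.exp (-c) * ∑ i, Real.exp (θ * signPairing ε (v i)) + (c - 1) := fun ε => by
    obtain ⟨i, hi⟩ := exists_eq_ciSup_of_finite (f := fun i => signPairing ε (v i))
    rw [← hi]
    have h1 := Real.add_one_le_exp (θ * signPairing ε (v i) - c)
    rw [sub_eq_neg_add, Real.exp_add] at h1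
    have h2 : Real.exp (θ * signPairing ε (v i)) ≤ ∑ i, Real.exp (θ * signPairing ε (v i)) :=
      Finset.single_le_sum (f := fun i => Real.exp (θ * signPairing ε (v i)))
        (fun i _ => (Real.exp_pos _).le) (Finset.mem_univ i)
    have h3 := mul_le_mul_of_nonneg_left h2 (Real.exp_pos (-c)).le
    linarith
  have h1 := signAvg_mono key
  rw [signAvg_const_mul, signAvg_add, signAvg_const_mul, signAvg_sum, signAvg_const] at h1
  have h2 : ∑ i, signAvg (fun ε => Real.exp (θ * signPairing ε (v i)))
      ≤ M * Real.exp (θ ^ 2 * σ ^ 2 / 2) := by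
    calc ∑ i, signAvg (fun ε => Real.exp (θ * signPairing ε (v i)))
        ≤ ∑ _i : ι, Real.exp (θ ^ 2 * σ ^ 2 / 2) := by
          refine Finset.sum_le_sum fun i _ => (signAvg_exp_le (v i) θ).trans ?_
          gcongr
          exact hv i
      _ ≤ M * Real.exp (θ ^ 2 * σ ^ 2 / 2) := by
          rw [Finset.sum_const, nsmul_eq_mul, Finset.card_univ]
          gcongr
  have h3 : M * Real.exp (θ ^ 2 * σ ^ 2 / 2) = Real.exp c := by
    rw [hc, Real.exp_add, Real.exp_log (by linarith)]
  rw [h3] at h2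
  have h4 := mul_le_mul_of_nonneg_left h2 (Real.exp_pos (-c)).le
  rw [← Real.exp_add, neg_add_cancel, Real.exp_zero] at h4
  change θ * signAvg _ ≤ c
  linarith

/-- One link of a chain. The differences are indexed by `ι` alone, because `q` is a function, so the
maximal inequality need not count pairs. -/
theorem rademacher_le_sub_add {m : ℕ} {ι κ : Type*} [Finite ι] [Nonempty ι] [Finite κ]
    (v : ι → Vec m) (w : κ → Vec m) (q : ι → κ) :
    rademacher v ≤ rademacher (fun i => v i - w (q i)) + rademacher w := by
  rw [rademacher, rademacher, rademacher, ← signAvg_add]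
  refine signAvg_mono fun ε => ciSup_le fun i => ?_
  have h1 := le_ciSup (f := fun i => signPairing ε (v i - w (q i)))
    (Set.finite_range _).bddAbove i
  have h2 := le_ciSup (f := fun k => signPairing ε (w k)) (Set.finite_range _).bddAbove (q i)
  have h3 := signPairing_add ε (v i - w (q i)) (w (q i))
  rw [sub_add_cancel] at h3
  rw [h3]
  exact add_le_add h1 h2

theorem rademacher_const {m : ℕ} (v₀ : Vec m) : rademacher (fun _ : Unit => v₀) = 0 := by
  simp [rademacher, signAvg_signPairing]

theorem signPairing_le {m : ℕ} (ε : Fin m → Bool) (v : Vec m) :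
    signPairing ε v ≤ √m * ‖v‖ := by
  have h1 : signPairing ε v ≤ ∑ j, 1 * |v j| := by
    refine Finset.sum_le_sum fun j _ => (le_abs_self _).trans ?_
    rw [abs_mul, abs_sgn]
  refine h1.trans ((Real.sum_mul_le_sqrt_mul_sqrt _ _ _).trans ?_)
  simp [EuclideanSpace.norm_eq]

theorem rademacher_le_of_norm_le {m : ℕ} {ι : Type*} [Nonempty ι] (v : ι → Vec m) {σ : ℝ}
    (hv : ∀ i, ‖v i‖ ≤ σ) : rademacher v ≤ √m * σ := by
  rw [← signAvg_const (m := m) (√m * σ)]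
  refine signAvg_mono fun ε => ciSup_le fun i => (signPairing_le ε (v i)).trans ?_
  gcongr
  exact hv i

/-- Dyadic chaining. -/
theorem rademacher_chaining {m : ℕ} (V : Set (Vec m)) (v₀ : Vec m) {Δ : ℝ} (hΔ : 0 < Δ)
    (hV : ∀ v ∈ V, ‖v - v₀‖ ≤ Δ) (T : ℕ → Finset (Vec m)) (C : ℕ → ℝ)
    (hTV : ∀ k, (T k : Set (Vec m)) ⊆ V) (hC : ∀ k, ((T k).card : ℝ) ≤ C k)
    (hT : ∀ k, ∀ v ∈ V, ∃ t ∈ T k, dist v t ≤ Δ / 2 ^ (k + 1))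
    {ι : Type*} [Finite ι] [Nonempty ι] (v : ι → Vec m) (hv : ∀ i, v i ∈ V) (K : ℕ) :
    rademacher v ≤ ∑ k ∈ Finset.range (K + 1), Δ / 2 ^ k * √(2 * Real.log (C k))
      + √m * (Δ / 2 ^ (K + 1)) := by
  have hne : ∀ k, Nonempty (T k) := fun k => by
    obtain ⟨t, ht, -⟩ := hT k _ (hv (Classical.arbitrary ι))
    exact ⟨⟨t, ht⟩⟩
  have hnet : ∀ k, ∀ w ∈ V, ∃ t : T k, ‖w - (t : Vec m)‖ ≤ Δ / 2 ^ (k + 1) := fun k w hw => by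
    obtain ⟨t, ht, hd⟩ := hT k w hw
    exact ⟨⟨t, ht⟩, by rwa [← dist_eq_norm]⟩
  have hind : ∀ K, rademacher (fun t : T K => (t : Vec m))
      ≤ ∑ k ∈ Finset.range (K + 1), Δ / 2 ^ k * √(2 * Real.log (C k)) := by
    intro K
    induction K with
    | zero =>
      have h1 := rademacher_le_sub_add (fun t : T 0 => (t : Vec m)) (fun _ : Unit => v₀)
        fun _ => ()
      have h2 := rademacher_le_of_card (fun t : T 0 => (t : Vec m) - v₀) hΔ
        (fun t => hV _ (hTV 0 t.2)) (M := C 0) (by simpa using hC 0)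
      rw [rademacher_const] at h1
      simpa using h1.trans (add_le_add_left h2 0)
    | succ K ih =>
      -- Each net is projected onto the next coarser one. Nets consist of points of `V`, so a link
      -- at this level has length at most `Δ / 2 ^ (K + 1)`.
      choose q hq using fun t : T (K + 1) => hnet K t (hTV _ t.2)
      have h1 := rademacher_le_sub_add (fun t : T (K + 1) => (t : Vec m))
        (fun t : T K => (t : Vec m)) q
      have h2 := rademacher_le_of_card (fun t : T (K + 1) => (t : Vec m) - (q t : Vec m))
        (by positivity) hq (M := C (K + 1)) (by simpa using hC (K + 1))
      rw [Finset.sum_range_succ]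
      linarith
  choose q hq using fun i => hnet K (v i) (hv i)
  have h1 := rademacher_le_sub_add v (fun t : T K => (t : Vec m)) q
  have h2 := rademacher_le_of_norm_le (fun i => v i - (q i : Vec m)) hq
  linarith [hind K]

theorem sum_range_div_two_pow_succ (K : ℕ) :
    ∑ k ∈ Finset.range K, (k : ℝ) / 2 ^ k = 2 - (2 * K + 2) / 2 ^ K := by
  induction K with
  | zero => simp
  | succ K ih =>
    rw [Finset.sum_range_succ, ih, pow_succ]
    push_cast
    field_simp
    ring

theorem sum_range_one_div_two_pow_le (K : ℕ) : ∑ k ∈ Finset.range K, (1 : ℝ) / 2 ^ k ≤ 2 := by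
  have h : ∑ k ∈ Finset.range K, (1 : ℝ) / 2 ^ k = 2 - 2 / 2 ^ K := by
    induction K with
    | zero => simp
    | succ K ih =>
      rw [Finset.sum_range_succ, ih, pow_succ]
      field_simp
      ring
  have : (0 : ℝ) < 2 / 2 ^ K := by positivity
  linarith

/-- The dyadic entropy sum. -/
theorem sum_entropy_le {u : ℝ} (hu : 0 ≤ u) (K : ℕ) :
    ∑ k ∈ Finset.range K, (1 : ℝ) / 2 ^ k * √(Real.log (1 + 2 ^ (k + 1) * u))
      ≤ 2 * √(Real.log (Real.exp 1 * (1 + 2 * u))) := by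
  set a := Real.log (1 + 2 * u) with ha
  have ha0 : 0 ≤ a := Real.log_nonneg (by linarith)
  have hlog : Real.log (Real.exp 1 * (1 + 2 * u)) = 1 + a := by
    rw [Real.log_mul (Real.exp_pos 1).ne' (by positivity), Real.log_exp]
  have hterm : ∀ k : ℕ, Real.log (1 + 2 ^ (k + 1) * u) ≤ k * Real.log 2 + a := fun k => by
    rw [ha, ← Real.log_pow, ← Real.log_mul (by positivity) (by positivity)]
    apply Real.log_le_log (by positivity)
    have : (1 : ℝ) ≤ 2 ^ k := one_le_pow₀ (by norm_num)
    rw [pow_succ]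
    nlinarith
  have hlog2 : Real.log 2 ≤ 1 := by linarith [Real.log_two_lt_d9]
  -- Cauchy–Schwarz with weights `1 / 2 ^ k`. The sums of `1 / 2 ^ k` and of `k / 2 ^ k` are both at
  -- most `2`; the second accounts for the summand `1 = log e`.
  have h1 : ∑ k ∈ Finset.range K, (1 : ℝ) / 2 ^ k * √(Real.log (1 + 2 ^ (k + 1) * u))
      ≤ ∑ k ∈ Finset.range K, √((1 : ℝ) / 2 ^ k) * √((1 / 2 ^ k) * (k + a)) := by
    refine Finset.sum_le_sum fun k _ => ?_
    rw [← Real.sqrt_mul (by positivity), ← mul_assoc, Real.sqrt_mul (by positivity),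
      Real.sqrt_mul_self (by positivity)]
    gcongr
    refine (hterm k).trans ?_
    have : (k : ℝ) * Real.log 2 ≤ k := mul_le_of_le_one_right (by positivity) hlog2
    linarith
  have h2 := Real.sum_sqrt_mul_sqrt_le (Finset.range K) (f := fun k : ℕ => (1 : ℝ) / 2 ^ k)
    (g := fun k : ℕ => (1 / 2 ^ k) * ((k : ℝ) + a)) (fun k => by positivity) (fun k => by positivity)
  have h3 : ∑ k ∈ Finset.range K, (1 : ℝ) / 2 ^ k * ((k : ℝ) + a) ≤ 2 * (1 + a) := by
    have h4 : ∑ k ∈ Finset.range K, (1 : ℝ) / 2 ^ k * ((k : ℝ) + a)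
        = ∑ k ∈ Finset.range K, (k : ℝ) / 2 ^ k + (∑ k ∈ Finset.range K, (1 : ℝ) / 2 ^ k) * a := by
      rw [Finset.sum_mul, ← Finset.sum_add_distrib]
      refine Finset.sum_congr rfl fun k _ => by ring
    rw [h4, sum_range_div_two_pow_succ]
    have h5 := mul_le_mul_of_nonneg_right (sum_range_one_div_two_pow_le K) ha0
    have h6 : (0 : ℝ) ≤ (2 * K + 2) / 2 ^ K := by positivity
    linarith
  rw [hlog]
  refine h1.trans (h2.trans ?_)
  calc √(∑ k ∈ Finset.range K, (1 : ℝ) / 2 ^ k) *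
        √(∑ k ∈ Finset.range K, (1 : ℝ) / 2 ^ k * ((k : ℝ) + a))
      ≤ √2 * √(2 * (1 + a)) := by
        gcongr
        exact sum_range_one_div_two_pow_le K
    _ = 2 * √(1 + a) := by
        rw [Real.sqrt_mul (by norm_num), ← mul_assoc, Real.mul_self_sqrt (by norm_num)]

theorem sqrt_add_le {x y : ℝ} (hx : 0 ≤ x) (hy : 0 ≤ y) : √(x + y) ≤ √x + √y := by
  rw [Real.sqrt_le_left (by positivity), add_sq, Real.sq_sqrt hx, Real.sq_sqrt hy]
  have : 0 ≤ 2 * √x * √y := by positivity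
  linarith

/-- The entropy bound for a class whose nets are controlled by two polynomial factors. -/
theorem rademacher_le_entropy {m : ℕ} (V : Set (Vec m)) (v₀ : Vec m) {Δ u₁ u₂ : ℝ} (hΔ : 0 < Δ)
    (hu₁ : 0 ≤ u₁) (hu₂ : 0 ≤ u₂) (d₁ d₂ : ℕ) (hV : ∀ v ∈ V, ‖v - v₀‖ ≤ Δ)
    (hT : ∀ k : ℕ, ∃ T : Finset (Vec m), (T : Set (Vec m)) ⊆ V ∧
      (T.card : ℝ) ≤ (1 + 2 ^ (k + 1) * u₁) ^ d₁ * (1 + 2 ^ (k + 1) * u₂) ^ d₂ ∧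
      ∀ v ∈ V, ∃ t ∈ T, dist v t ≤ Δ / 2 ^ (k + 1))
    {ι : Type*} [Finite ι] [Nonempty ι] (v : ι → Vec m) (hv : ∀ i, v i ∈ V) :
    rademacher v ≤ 2 * √2 * Δ * (√d₁ * √(Real.log (Real.exp 1 * (1 + 2 * u₁)))
      + √d₂ * √(Real.log (Real.exp 1 * (1 + 2 * u₂)))) := by
  choose T hTV hcard hnet using hT
  set B := 2 * √2 * Δ * (√d₁ * √(Real.log (Real.exp 1 * (1 + 2 * u₁)))
      + √d₂ * √(Real.log (Real.exp 1 * (1 + 2 * u₂)))) with hB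
  have hterm : ∀ k : ℕ, Δ / 2 ^ k * √(2 * Real.log
        ((1 + 2 ^ (k + 1) * u₁) ^ d₁ * (1 + 2 ^ (k + 1) * u₂) ^ d₂))
      ≤ √2 * Δ * (√d₁ * (1 / 2 ^ k * √(Real.log (1 + 2 ^ (k + 1) * u₁)))
        + √d₂ * (1 / 2 ^ k * √(Real.log (1 + 2 ^ (k + 1) * u₂)))) := fun k => by
    have p₁ : 0 < 1 + 2 ^ (k + 1) * u₁ := by positivity
    have p₂ : 0 < 1 + 2 ^ (k + 1) * u₂ := by positivity
    have l₁ : 0 ≤ Real.log (1 + 2 ^ (k + 1) * u₁) :=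
      Real.log_nonneg (le_add_of_nonneg_right (by positivity))
    have l₂ : 0 ≤ Real.log (1 + 2 ^ (k + 1) * u₂) :=
      Real.log_nonneg (le_add_of_nonneg_right (by positivity))
    rw [Real.log_mul (by positivity) (by positivity), Real.log_pow, Real.log_pow,
      Real.sqrt_mul (by norm_num)]
    have h := sqrt_add_le
      (x := d₁ * Real.log (1 + 2 ^ (k + 1) * u₁)) (y := d₂ * Real.log (1 + 2 ^ (k + 1) * u₂))
      (by positivity) (by positivity)
    rw [Real.sqrt_mul (by positivity), Real.sqrt_mul (by positivity)] at h
    calc _ ≤ Δ / 2 ^ k * (√2 * (√d₁ * √(Real.log (1 + 2 ^ (k + 1) * u₁))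
            + √d₂ * √(Real.log (1 + 2 ^ (k + 1) * u₂)))) := by gcongr
      _ = _ := by ring
  have hbound : ∀ K : ℕ, rademacher v ≤ B + √m * (Δ / 2 ^ (K + 1)) := fun K => by
    refine (rademacher_chaining V v₀ hΔ hV T _ hTV hcard hnet v hv K).trans ?_
    gcongr
    refine (Finset.sum_le_sum fun k _ => hterm k).trans ?_
    rw [← Finset.mul_sum, Finset.sum_add_distrib, ← Finset.mul_sum, ← Finset.mul_sum, hB]
    calc _ ≤ √2 * Δ * (√d₁ * (2 * √(Real.log (Real.exp 1 * (1 + 2 * u₁))))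
        + √d₂ * (2 * √(Real.log (Real.exp 1 * (1 + 2 * u₂))))) := by
          gcongr
          · exact sum_entropy_le hu₁ _
          · exact sum_entropy_le hu₂ _
      _ = _ := by ring
  -- The chain stops at a finite level; the remainder, estimated trivially, tends to zero.
  have hlim : Filter.Tendsto (fun K : ℕ => B + √m * (Δ / 2 ^ (K + 1))) Filter.atTop
      (nhds (B + √m * 0)) := by
    refine Filter.Tendsto.const_add _ (Filter.Tendsto.const_mul _ ?_)
    refine Filter.Tendsto.div_atTop tendsto_const_nhds ?_
    exact (tendsto_pow_atTop_atTop_of_one_lt one_lt_two).comp (Filter.tendsto_add_atTop_nat 1)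
  rw [mul_zero, add_zero] at hlim
  exact ge_of_tendsto' hlim hbound

end Rademacher

end LISTA

namespace LISTA

open MeasureTheory Module ProbabilityTheory

/-! ### McDiarmid's inequality -/

noncomputable section Concentration

theorem integrable_of_measurable_of_abs_le {Ω : Type*} [MeasurableSpace Ω] {μ : Measure Ω}
    [IsFiniteMeasure μ] {F : Ω → ℝ} (hF : Measurable F) (C : ℝ) (hC : ∀ x, |F x| ≤ C) :
    Integrable F μ :=
  Integrable.of_bound hF.aestronglyMeasurable C (Filter.Eventually.of_forall hC)

theorem integral_comp_of_measurePreserving {Ω Ω' : Type*} [MeasurableSpace Ω]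
    [MeasurableSpace Ω'] {μ : Measure Ω} {ν : Measure Ω'} {g : Ω → Ω'}
    (hg : MeasurePreserving g μ ν) {F : Ω' → ℝ} (hF : Measurable F) :
    ∫ x, F (g x) ∂μ = ∫ y, F y ∂ν := by
  rw [← hg.map_eq, integral_map hg.aemeasurable hF.aestronglyMeasurable]

theorem abs_integral_le_of_abs_le {Ω : Type*} [MeasurableSpace Ω] {μ : Measure Ω}
    [IsProbabilityMeasure μ] {F : Ω → ℝ} {C : ℝ} (hC : ∀ x, |F x| ≤ C) :
    |∫ x, F x ∂μ| ≤ C := by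
  have := norm_integral_le_of_norm_le_const (μ := μ) (f := F) (C := C)
    (Filter.Eventually.of_forall hC)
  simpa using this

theorem integral_exp_le_of_bounded_oscillation {Ω : Type*} [MeasurableSpace Ω] {μ : Measure Ω}
    [IsProbabilityMeasure μ] {F : Ω → ℝ} (hF : Measurable F) {c : ℝ}
    (hc : ∀ x y, |F x - F y| ≤ c) (θ : ℝ) :
    ∫ x, Real.exp (θ * (F x - ∫ y, F y ∂μ)) ∂μ ≤ Real.exp (θ ^ 2 * c ^ 2 / 2) := by
  obtain ⟨x₀⟩ : Nonempty Ω := nonempty_of_isProbabilityMeasure μ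
  -- An interval of length `2 * c` around one value suffices for Hoeffding's lemma. It costs a
  -- factor `4` in the exponent against the sharp bound, which the final constants absorb.
  have h := hasSubgaussianMGF_of_mem_Icc (μ := μ) (X := F) (a := F x₀ - c) (b := F x₀ + c)
    hF.aemeasurable (Filter.Eventually.of_forall fun x => by
      have := abs_le.1 (hc x x₀)
      constructor <;> linarith)
  refine (h.mgf_le θ).trans (le_of_eq ?_)
  congr 1
  have : F x₀ + c - (F x₀ - c) = 2 * c := by ring
  simp only [this, NNReal.coe_pow, NNReal.coe_div, coe_nnnorm, norm_mul, Real.norm_eq_abs,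
    NNReal.coe_ofNat, abs_two]
  rw [mul_div_cancel_left₀ _ two_ne_zero, sq_abs]
  ring

theorem abs_exp_mul_sub_le {C s t : ℝ} (θ : ℝ) (hs : |s| ≤ C) (ht : |t| ≤ C) :
    |Real.exp (θ * (s - t))| ≤ Real.exp (|θ| * (C + C)) := by
  rw [Real.abs_exp, Real.exp_le_exp]
  refine (le_abs_self _).trans ?_
  rw [abs_mul]
  gcongr
  exact (abs_sub s t).trans (add_le_add hs ht)

/-- The moment generating function bound of McDiarmid's inequality. -/
theorem integral_exp_le_of_bounded_differences {X : Type*} [MeasurableSpace X] (D : Measure X)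
    [IsProbabilityMeasure D] {c : ℝ} (θ : ℝ) (m : ℕ) :
    ∀ (G : (Fin m → X) → ℝ) (C : ℝ), Measurable G → (∀ x, |G x| ≤ C) →
      (∀ x i a, |G (Function.update x i a) - G x| ≤ c) →
      ∫ x, Real.exp (θ * (G x - ∫ y, G y ∂Measure.pi fun _ => D)) ∂(Measure.pi fun _ => D)
        ≤ Real.exp (m * (θ ^ 2 * c ^ 2 / 2)) := by
  induction m with
  | zero =>
    intro G C hG hC _
    have h0 : ∀ x y : Fin 0 → X, G x = G y := fun x y => by rw [Subsingleton.elim x y]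
    have h1 : ∀ x : Fin 0 → X, ∫ y, G y ∂(Measure.pi fun _ : Fin 0 => D) = G x := fun x => by
      rw [integral_congr_ae (Filter.Eventually.of_forall fun y => h0 y x)]
      simp
    have h2 : ∀ x : Fin 0 → X,
        Real.exp (θ * (G x - ∫ y, G y ∂(Measure.pi fun _ : Fin 0 => D))) = 1 := fun x => by
      rw [h1 x]; simp
    simp [h2]
  | succ m ih =>
    intro G C hG hC hdiff
    set μ := Measure.pi fun _ : Fin m => D with hμ
    have hcons : Measurable fun p : X × (Fin m → X) => (Fin.cons p.1 p.2 : Fin (m + 1) → X) := by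
      rw [measurable_pi_iff]
      intro i
      refine Fin.cases ?_ (fun j => ?_) i
      · simpa using measurable_fst
      · simp only [Fin.cons_succ]
        fun_prop
    have hmp : MeasurePreserving
        (fun p : X × (Fin m → X) => (Fin.cons p.1 p.2 : Fin (m + 1) → X))
        (D.prod μ) (Measure.pi fun _ => D) := by
      have := (measurePreserving_piFinSuccAbove (fun _ : Fin (m + 1) => D) 0).symm
      convert this using 1
      ext p i
      simp [MeasurableEquiv.piFinSuccAbove_symm_apply, Fin.insertNthEquiv]
    set H : X × (Fin m → X) → ℝ := fun p => G (Fin.cons p.1 p.2) with hH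
    have hHm : Measurable H := hG.comp hcons
    -- Averaging out the first coordinate preserves bounded differences, so induction applies to
    -- `g`; Hoeffding's lemma handles `H (a, x) - g x` for fixed `x`.
    set g : (Fin m → X) → ℝ := fun x => ∫ a, H (a, x) ∂D with hg
    have hgm : Measurable g := (hHm.stronglyMeasurable.integral_prod_left' (μ := D)).measurable
    have hHC : ∀ p, |H p| ≤ C := fun p => hC _
    have hgC : ∀ x, |g x| ≤ C := fun x => abs_integral_le_of_abs_le fun a => hHC _
    have hHi : ∀ x, Integrable (fun a => H (a, x)) D := fun x =>
      integrable_of_measurable_of_abs_le (hHm.comp (measurable_id.prodMk measurable_const)) C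
        fun a => hHC _
    have hmean : ∫ y, G y ∂(Measure.pi fun _ : Fin (m + 1) => D) = ∫ x, g x ∂μ := by
      rw [← integral_comp_of_measurePreserving hmp hG,
        integral_prod_symm _ (integrable_of_measurable_of_abs_le hHm C hHC)]
    have hgd : ∀ x i a, |g (Function.update x i a) - g x| ≤ c := fun x i a => by
      rw [hg]
      simp only
      rw [← integral_sub (hHi _) (hHi _)]
      refine abs_integral_le_of_abs_le fun b => ?_
      have := hdiff (Fin.cons b x) i.succ a
      rwa [← Fin.cons_update] at this
    have hIH := ih g C hgm hgC hgd
    have hexp_bound := fun s t : ℝ => abs_exp_mul_sub_le (C := C) (s := s) (t := t) θ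
    set E := ∫ x, g x ∂μ with hE
    have hEC : |E| ≤ C := abs_integral_le_of_abs_le hgC
    rw [hmean]
    have hGexp : Measurable fun x : Fin (m + 1) → X => Real.exp (θ * (G x - E)) := by fun_prop
    rw [← integral_comp_of_measurePreserving hmp hGexp, integral_prod_symm
      (fun p : X × (Fin m → X) => Real.exp (θ * (G (Fin.cons p.1 p.2) - E)))
      (integrable_of_measurable_of_abs_le (hGexp.comp hcons) _
        fun p => hexp_bound _ _ (hHC p) hEC)]
    have hinner : ∀ x, ∫ a, Real.exp (θ * (G (Fin.cons a x) - E)) ∂D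
        ≤ Real.exp (θ ^ 2 * c ^ 2 / 2) * Real.exp (θ * (g x - E)) := fun x => by
      have h1 : ∀ a, Real.exp (θ * (G (Fin.cons a x) - E))
          = Real.exp (θ * (H (a, x) - g x)) * Real.exp (θ * (g x - E)) := fun a => by
        rw [← Real.exp_add, ← mul_add, sub_add_sub_cancel]
      simp only [h1]
      rw [integral_mul_const]
      gcongr
      refine integral_exp_le_of_bounded_oscillation
        (hHm.comp (measurable_id.prodMk measurable_const)) (fun a b => ?_) θ
      have := hdiff (Fin.cons b x) 0 a
      rwa [Fin.update_cons_zero] at this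
    have hint1 : Integrable (fun x => ∫ a, Real.exp (θ * (G (Fin.cons a x) - E)) ∂D) μ := by
      refine Integrable.integral_prod_right (f := fun p : X × (Fin m → X) =>
        Real.exp (θ * (G (Fin.cons p.1 p.2) - E))) ?_
      exact integrable_of_measurable_of_abs_le (hGexp.comp hcons) _
        fun p => hexp_bound _ _ (hHC p) hEC
    have hint2 : Integrable
        (fun x => Real.exp (θ ^ 2 * c ^ 2 / 2) * Real.exp (θ * (g x - E))) μ := by
      refine Integrable.const_mul ?_ _
      exact integrable_of_measurable_of_abs_le (by fun_prop) _
        fun x => hexp_bound _ _ (hgC x) hEC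
    calc _ ≤ ∫ x, Real.exp (θ ^ 2 * c ^ 2 / 2) * Real.exp (θ * (g x - E)) ∂μ :=
          integral_mono hint1 hint2 hinner
      _ = Real.exp (θ ^ 2 * c ^ 2 / 2) * ∫ x, Real.exp (θ * (g x - E)) ∂μ :=
          integral_const_mul _ _
      _ ≤ Real.exp (θ ^ 2 * c ^ 2 / 2) * Real.exp (m * (θ ^ 2 * c ^ 2 / 2)) := by gcongr
      _ = Real.exp ((m + 1 : ℕ) * (θ ^ 2 * c ^ 2 / 2)) := by
          rw [← Real.exp_add]
          push_cast
          congr 1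
          ring

/-- McDiarmid's inequality for a function with nonpositive mean. -/
theorem measure_ge_le_of_bounded_differences {X : Type*} [MeasurableSpace X] (D : Measure X)
    [IsProbabilityMeasure D] {c C : ℝ} {m : ℕ} (G : (Fin m → X) → ℝ) (hG : Measurable G)
    (hC : ∀ x, |G x| ≤ C) (hdiff : ∀ x i a, |G (Function.update x i a) - G x| ≤ c)
    (hmean : ∫ x, G x ∂(Measure.pi fun _ => D) ≤ 0) {t : ℝ} (ht : 0 ≤ t) :
    (Measure.pi fun _ => D).real {x | t ≤ G x} ≤ Real.exp (-t ^ 2 / (2 * (m * c ^ 2))) := by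
  set μ := Measure.pi fun _ : Fin m => D
  set E := ∫ x, G x ∂μ
  have hEC : |E| ≤ C := abs_integral_le_of_abs_le hC
  have hsub : HasSubgaussianMGF (fun x => G x - E) (m * ‖c‖₊ ^ 2) μ := by
    refine ⟨fun θ => ?_, fun θ => ?_⟩
    · refine integrable_of_measurable_of_abs_le (by fun_prop) (Real.exp (|θ| * (C + C)))
        fun x => abs_exp_mul_sub_le θ (hC x) hEC
    · refine (integral_exp_le_of_bounded_differences D θ m G C hG hC hdiff).trans (le_of_eq ?_)
      congr 1
      simp
      ring
  have h := hsub.measure_ge_le ht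
  refine (measureReal_mono fun x hx => ?_).trans (h.trans (le_of_eq ?_))
  · simp only [Set.mem_ofPred_eq] at hx ⊢
    linarith
  · simp

end Concentration

/-! ### Symmetrization and uniform deviation for finite classes -/

noncomputable section Symmetrization

variable {X : Type*} {ι : Type*} {m : ℕ}

/-- The vector `(f(x₁), …, f(x_m))`. -/
def sampleVec (f : X → ℝ) (x : Fin m → X) : Vec m := WithLp.toLp 2 fun j => f (x j)

theorem signPairing_sampleVec (ε : Fin m → Bool) (f : X → ℝ) (x : Fin m → X) :
    signPairing ε (sampleVec f x) = ∑ j, sgn (ε j) * f (x j) := rfl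

/-- The largest (unnormalised) gap between expectations and sample averages. -/
def maxGap [MeasurableSpace X] (D : Measure X) (f : ι → X → ℝ) (x : Fin m → X) : ℝ :=
  ⨆ i, ∑ j, (∫ a, f i a ∂D - f i (x j))

theorem le_iSup_of_finite [Finite ι] (F : ι → ℝ) (i : ι) : F i ≤ ⨆ i, F i :=
  le_ciSup (Set.finite_range F).bddAbove i

theorem abs_iSup_sub_iSup_le [Finite ι] [Nonempty ι] {F G : ι → ℝ} {c : ℝ}
    (h : ∀ i, |F i - G i| ≤ c) : |(⨆ i, F i) - ⨆ i, G i| ≤ c := by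
  rw [abs_sub_le_iff]
  constructor
  · rw [sub_le_iff_le_add]
    refine ciSup_le fun i => ?_
    linarith [(abs_le.1 (h i)).2, le_iSup_of_finite G i]
  · rw [sub_le_iff_le_add]
    refine ciSup_le fun i => ?_
    linarith [(abs_le.1 (h i)).1, le_iSup_of_finite F i]

theorem abs_iSup_le_of_finite [Finite ι] [Nonempty ι] {F : ι → ℝ} {c : ℝ}
    (h : ∀ i, |F i| ≤ c) : |⨆ i, F i| ≤ c := by
  have := abs_iSup_sub_iSup_le (F := F) (G := fun _ => 0) (c := c) (by simpa using h)
  simpa using this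

theorem abs_sum_le_of_abs_le {F : Fin m → ℝ} {c : ℝ} (h : ∀ j, |F j| ≤ c) :
    |∑ j, F j| ≤ m * c := by
  refine (Finset.abs_sum_le_sum_abs _ _).trans ((Finset.sum_le_sum fun j _ => h j).trans ?_)
  simp

theorem abs_signAvg_le {F : (Fin m → Bool) → ℝ} {c : ℝ} (h : ∀ ε, |F ε| ≤ c) :
    |signAvg F| ≤ c := by
  rw [abs_le]
  constructor
  · rw [← signAvg_const (m := m) (-c)]
    exact signAvg_mono fun ε => (abs_le.1 (h ε)).1
  · rw [← signAvg_const (m := m) c]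
    exact signAvg_mono fun ε => (abs_le.1 (h ε)).2

variable [MeasurableSpace X]

theorem measurable_iSup_signPairing [Finite ι] {f : ι → X → ℝ} (hf : ∀ i, Measurable (f i))
    (ε : Fin m → Bool) :
    Measurable fun x : Fin m → X => ⨆ i, signPairing ε (sampleVec (f i) x) := by
  refine Measurable.iSup fun i => ?_
  simp only [signPairing_sampleVec]
  have := hf i
  fun_prop

theorem measurable_rademacher [Finite ι] {f : ι → X → ℝ} (hf : ∀ i, Measurable (f i)) :
    Measurable fun x : Fin m → X => rademacher fun i => sampleVec (f i) x := by
  unfold rademacher signAvg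
  refine Measurable.div_const (Finset.measurable_sum _ fun ε _ => ?_) _
  exact measurable_iSup_signPairing hf ε

theorem measurable_maxGap [Finite ι] (D : Measure X) {f : ι → X → ℝ}
    (hf : ∀ i, Measurable (f i)) : Measurable (maxGap (m := m) D f) := by
  refine Measurable.iSup fun i => ?_
  have := hf i
  fun_prop

theorem integrable_iSup_signPairing [Finite ι] [Nonempty ι] (μ : Measure (Fin m → X))
    [IsFiniteMeasure μ] {f : ι → X → ℝ} (hf : ∀ i, Measurable (f i)) {c : ℝ}
    (hc : ∀ i a, |f i a| ≤ c) (ε : Fin m → Bool) :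
    Integrable (fun x : Fin m → X => ⨆ i, signPairing ε (sampleVec (f i) x)) μ := by
  refine integrable_of_measurable_of_abs_le (measurable_iSup_signPairing hf ε) (m * c)
    fun x => abs_iSup_le_of_finite fun i => abs_sum_le_of_abs_le fun j => ?_
  rw [abs_mul, abs_sgn, one_mul]
  exact hc i _

theorem integral_rademacher [Finite ι] [Nonempty ι] (μ : Measure (Fin m → X))
    [IsFiniteMeasure μ] {f : ι → X → ℝ} (hf : ∀ i, Measurable (f i)) {c : ℝ}
    (hc : ∀ i a, |f i a| ≤ c) :
    ∫ x, rademacher (fun i => sampleVec (f i) x) ∂μ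
      = signAvg fun ε => ∫ x, ⨆ i, signPairing ε (sampleVec (f i) x) ∂μ := by
  unfold rademacher signAvg
  rw [integral_div, integral_finsetSum _ fun ε _ => integrable_iSup_signPairing μ hf hc ε]

/-- Symmetrization. -/
theorem integral_maxGap_le [Finite ι] [Nonempty ι] (D : Measure X) [IsProbabilityMeasure D]
    {f : ι → X → ℝ} (hf : ∀ i, Measurable (f i)) {c : ℝ} (hc : ∀ i a, |f i a| ≤ c) :
    ∫ x, maxGap D f x ∂(Measure.pi fun _ : Fin m => D)
      ≤ 2 * ∫ x, rademacher (fun i => sampleVec (f i) x) ∂(Measure.pi fun _ : Fin m => D) := by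
  set μ := Measure.pi fun _ : Fin m => D with hμ
  set P := Measure.pi fun _ : Fin m => D.prod D with hP
  -- the difference of a sample and an independent copy
  set Z : (Fin m → X) × (Fin m → X) → ℝ :=
    fun p => ⨆ i, ∑ j, (f i (p.2 j) - f i (p.1 j)) with hZ
  have hZm : Measurable Z := by
    refine Measurable.iSup fun i => ?_
    have := hf i
    fun_prop
  have hZb : ∀ p, |Z p| ≤ m * (c + c) := fun p =>
    abs_iSup_le_of_finite fun i => abs_sum_le_of_abs_le fun j =>
      (abs_sub _ _).trans (add_le_add (hc i _) (hc i _))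
  have hZi : Integrable Z (μ.prod μ) := integrable_of_measurable_of_abs_le hZm _ hZb
  have hgapb : ∀ x : Fin m → X, |maxGap D f x| ≤ m * (c + c) := fun x =>
    abs_iSup_le_of_finite fun i => abs_sum_le_of_abs_le fun j =>
      (abs_sub _ _).trans (add_le_add (abs_integral_le_of_abs_le (hc i)) (hc i _))
  have hghost : ∀ x : Fin m → X, maxGap D f x ≤ ∫ x', Z (x, x') ∂μ := fun x => by
    refine ciSup_le fun i => ?_
    have hev : ∀ j, ∫ x', f i (x' j) ∂μ = ∫ a, f i a ∂D := fun j =>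
      integral_comp_of_measurePreserving (measurePreserving_eval (fun _ : Fin m => D) j) (hf i)
    have hevi : ∀ j, Integrable (fun x' : Fin m → X => f i (x' j)) μ := fun j =>
      integrable_of_measurable_of_abs_le ((hf i).comp (measurable_pi_apply j)) c
        fun x' => hc i _
    have hsubi : ∀ j, Integrable (fun x' : Fin m → X => f i (x' j) - f i (x j)) μ := fun j =>
      (hevi j).sub (integrable_const _)
    have h1 : ∑ j, (∫ a, f i a ∂D - f i (x j))
        = ∫ x', ∑ j, (f i (x' j) - f i (x j)) ∂μ := by
      rw [integral_finsetSum _ fun j _ => hsubi j]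
      refine Finset.sum_congr rfl fun j _ => ?_
      rw [integral_sub (hevi j) (integrable_const _), hev j]
      simp
    rw [h1]
    refine integral_mono (integrable_finsetSum _ fun j _ => hsubi j)
      (integrable_of_measurable_of_abs_le (hZm.comp (measurable_const.prodMk measurable_id)) _
        fun x' => hZb _) fun x' => ?_
    exact le_iSup_of_finite (fun i => ∑ j, (f i (x' j) - f i (x j))) i
  have hstep1 : ∫ x, maxGap D f x ∂μ ≤ ∫ p, Z p ∂(μ.prod μ) := by
    rw [integral_prod _ hZi]
    exact integral_mono (integrable_of_measurable_of_abs_le (measurable_maxGap D hf) _ hgapb)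
      hZi.integral_prod_left hghost
  set Z' : (Fin m → X × X) → ℝ := fun w => Z (fun j => (w j).1, fun j => (w j).2) with hZ'
  have hZ'm : Measurable Z' := hZm.comp (by fun_prop)
  have hstep2 : ∫ p, Z p ∂(μ.prod μ) = ∫ w, Z' w ∂P :=
    (integral_comp_of_measurePreserving (measurePreserving_arrowProdEquivProdArrow X X (Fin m)
      (fun _ => D) fun _ => D) hZm).symm
  have hsym : ∀ ε : Fin m → Bool, ∫ w, Z' w ∂P
      ≤ (∫ x, ⨆ i, signPairing ε (sampleVec (f i) x) ∂μ)
        + ∫ x, ⨆ i, signPairing (fun j => !ε j) (sampleVec (f i) x) ∂μ := fun ε => by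
    -- Exchanging a sample point with its independent copy wherever `ε` is false preserves the law
    -- and inserts the sign of `ε j` into each difference. The supremum then splits into one
    -- supremum per sample.
    have hswap : MeasurePreserving
        (fun (w : Fin m → X × X) j => if ε j then w j else (w j).swap) P P := by
      refine measurePreserving_pi _ _ (f := fun j (p : X × X) => if ε j then p else p.swap) fun j => ?_
      cases ε j
      · simpa using Measure.measurePreserving_swap
      · simpa using! MeasurePreserving.id (D.prod D)
    have hfst : MeasurePreserving (fun (w : Fin m → X × X) j => (w j).1) P μ :=
      measurePreserving_pi _ _ fun _ => measurePreserving_fst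
    have hsnd : MeasurePreserving (fun (w : Fin m → X × X) j => (w j).2) P μ :=
      measurePreserving_pi _ _ fun _ => measurePreserving_snd
    rw [← integral_comp_of_measurePreserving hswap hZ'm,
      ← integral_comp_of_measurePreserving hsnd (measurable_iSup_signPairing hf ε),
      ← integral_comp_of_measurePreserving hfst
        (measurable_iSup_signPairing hf fun j => !ε j)]
    have hi1 : Integrable (fun w : Fin m → X × X =>
        ⨆ i, signPairing ε (sampleVec (f i) fun j => (w j).2)) P :=
      hsnd.integrable_comp_of_integrable (integrable_iSup_signPairing μ hf hc ε)
    have hi2 : Integrable (fun w : Fin m → X × X =>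
        ⨆ i, signPairing (fun j => !ε j) (sampleVec (f i) fun j => (w j).1)) P :=
      hfst.integrable_comp_of_integrable (integrable_iSup_signPairing μ hf hc _)
    rw [← integral_add hi1 hi2]
    refine integral_mono (integrable_of_measurable_of_abs_le (hZ'm.comp hswap.measurable) _
      fun w => hZb _) (hi1.add hi2) fun w => ciSup_le fun i => ?_
    refine le_trans (le_of_eq ?_) (add_le_add
      (le_iSup_of_finite (fun i => signPairing ε (sampleVec (f i) fun j => (w j).2)) i)
      (le_iSup_of_finite
        (fun i => signPairing (fun j => !ε j) (sampleVec (f i) fun j => (w j).1)) i))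
    simp only [signPairing_sampleVec, ← Finset.sum_add_distrib]
    refine Finset.sum_congr rfl fun j _ => ?_
    cases ε j <;> simp [sgn] <;> ring
  have hstep3 : ∫ w, Z' w ∂P
      ≤ 2 * ∫ x, rademacher (fun i => sampleVec (f i) x) ∂μ := by
    have h := signAvg_mono hsym
    rw [signAvg_const, signAvg_add,
      signAvg_comp_not fun ε => ∫ x, ⨆ i, signPairing ε (sampleVec (f i) x) ∂μ,
      ← integral_rademacher μ hf hc] at h
    linarith
  exact hstep1.trans (hstep2.le.trans hstep3)

theorem sum_update_sub {Y : Type*} (g : Fin m → Y → ℝ) (x : Fin m → Y) (k : Fin m) (a : Y) :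
    ∑ j, g j (Function.update x k a j) - ∑ j, g j (x j) = g k a - g k (x k) := by
  rw [← Finset.sum_sub_distrib, Finset.sum_eq_single k]
  · simp
  · intro j _ hj
    simp [Function.update_of_ne hj]
  · simp

/-- The uniform deviation inequality for a finite class of functions with values in `[0, c]`. -/
theorem measure_maxGap_ge_le [Finite ι] [Nonempty ι] (D : Measure X) [IsProbabilityMeasure D]
    {f : ι → X → ℝ} (hf : ∀ i, Measurable (f i)) {c : ℝ} (h0 : ∀ i a, 0 ≤ f i a)
    (hc : ∀ i a, f i a ≤ c) {t : ℝ} (ht : 0 ≤ t) :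
    (Measure.pi fun _ : Fin m => D).real
        {x | 2 * rademacher (fun i => sampleVec (f i) x) + t ≤ maxGap D f x}
      ≤ Real.exp (-t ^ 2 / (2 * (m * (3 * c) ^ 2))) := by
  have habs : ∀ i a, |f i a| ≤ c := fun i a => by
    rw [abs_of_nonneg (h0 i a)]; exact hc i a
  have hdist : ∀ i a b, |f i a - f i b| ≤ c := fun i a b => by
    rw [abs_le]
    constructor <;> linarith [h0 i a, h0 i b, hc i a, hc i b]
  set μ := Measure.pi fun _ : Fin m => D with hμ
  set R : (Fin m → X) → ℝ := fun x => rademacher fun i => sampleVec (f i) x with hR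
  have hgapb : ∀ x : Fin m → X, |maxGap D f x| ≤ m * (c + c) := fun x =>
    abs_iSup_le_of_finite fun i => abs_sum_le_of_abs_le fun j =>
      (abs_sub _ _).trans (add_le_add (abs_integral_le_of_abs_le (habs i)) (habs i _))
  have hRb : ∀ x, |R x| ≤ m * c := fun x =>
    abs_signAvg_le fun ε => abs_iSup_le_of_finite fun i => abs_sum_le_of_abs_le fun j => by
      rw [abs_mul, abs_sgn, one_mul]
      exact habs i _
  have hgapd : ∀ (x : Fin m → X) k a, |maxGap D f (Function.update x k a) - maxGap D f x| ≤ c :=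
    fun x k a => abs_iSup_sub_iSup_le fun i => by
      rw [sum_update_sub (fun _ b => ∫ a, f i a ∂D - f i b)]
      simpa [abs_sub_comm] using hdist i (x k) a
  have hRd : ∀ x k a, |R (Function.update x k a) - R x| ≤ c := fun x k a => by
    have h1 : R (Function.update x k a) - R x = signAvg fun ε =>
        (⨆ i, signPairing ε (sampleVec (f i) (Function.update x k a)))
          - ⨆ i, signPairing ε (sampleVec (f i) x) := by
      simp only [hR, rademacher, signAvg, Finset.sum_sub_distrib, sub_div]
    rw [h1]
    refine abs_signAvg_le fun ε => abs_iSup_sub_iSup_le fun i => ?_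
    simp only [signPairing_sampleVec]
    rw [sum_update_sub (fun j b => sgn (ε j) * f i b), ← mul_sub, abs_mul, abs_sgn, one_mul]
    exact hdist i _ _
  have hRm : Measurable R := measurable_rademacher hf
  have hgm : Measurable (maxGap (m := m) D f) := measurable_maxGap D hf
  -- The gap changes by at most `c` and twice the complexity by at most `2 * c`. Subtracting the
  -- empirical complexity here avoids a second concentration step.
  have h := measure_ge_le_of_bounded_differences D (c := 3 * c) (C := m * (c + c) + 2 * (m * c))
    (fun x : Fin m → X => maxGap D f x - 2 * R x) (by fun_prop)
    (fun x => by
      have h1 := abs_le.1 (hgapb x)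
      have h2 := abs_le.1 (hRb x)
      rw [abs_le]
      constructor <;> linarith)
    (fun x k a => by
      have h1 := abs_le.1 (hgapd x k a)
      have h2 := abs_le.1 (hRd x k a)
      rw [abs_le]
      constructor <;> linarith)
    (by
      rw [integral_sub (integrable_of_measurable_of_abs_le hgm _ hgapb)
        ((integrable_of_measurable_of_abs_le hRm _ hRb).const_mul _), integral_const_mul]
      linarith [integral_maxGap_le (m := m) D hf habs]) ht
  refine (measureReal_mono fun x hx => ?_).trans h
  simp only [Set.mem_ofPred_eq] at hx ⊢
  linarith

end Symmetrization

end LISTA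

namespace LISTA

open MeasureTheory Module

/-! ### Lipschitz estimates for the unrolled network -/

noncomputable section Network

section MatrixNorms

open scoped Matrix.Norms.L2Operator

theorem norm_mulE_le {p q : ℕ} (M : Matrix (Fin p) (Fin q) ℝ) (v : Vec q) :
    ‖mulE M v‖ ≤ opNorm M * ‖v‖ := Matrix.l2_opNorm_mulVec M v

theorem opNorm_nonneg {p q : ℕ} (M : Matrix (Fin p) (Fin q) ℝ) : 0 ≤ opNorm M := norm_nonneg M

theorem opNorm_add_le {p q : ℕ} (M M' : Matrix (Fin p) (Fin q) ℝ) :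
    opNorm (M + M') ≤ opNorm M + opNorm M' := norm_add_le M M'

theorem opNorm_mul_le {p q r : ℕ} (M : Matrix (Fin p) (Fin q) ℝ) (M' : Matrix (Fin q) (Fin r) ℝ) :
    opNorm (M * M') ≤ opNorm M * opNorm M' := Matrix.l2_opNorm_mul M M'

theorem opNorm_transpose {p q : ℕ} (M : Matrix (Fin p) (Fin q) ℝ) :
    opNorm M.transpose = opNorm M := by
  rw [← Matrix.conjTranspose_eq_transpose_of_trivial]
  exact Matrix.l2_opNorm_conjTranspose M

/-- By the C*-identity, `‖Φ‖ ^ 2` is the norm of the identity matrix. That norm is only bounded by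
`1`, as it vanishes for `N = 0`. -/
theorem opNorm_le_one_of_mem_orthogonalGroup {N : ℕ} {Φ : Matrix (Fin N) (Fin N) ℝ}
    (hΦ : Φ ∈ Matrix.orthogonalGroup (Fin N) ℝ) : opNorm Φ ≤ 1 := by
  have h1 : Φ.conjTranspose * Φ = 1 := Matrix.mem_unitaryGroup_iff'.1 hΦ
  have h2 := Matrix.l2_opNorm_conjTranspose_mul_self Φ
  have h3 : ‖(1 : Matrix (Fin N) (Fin N) ℝ)‖ ≤ 1 := by
    rw [← Matrix.diagonal_one, Matrix.l2_opNorm_diagonal]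
    exact (pi_norm_const_le (1 : ℝ)).trans (by simp)
  rw [h1] at h2
  have h4 : ‖Φ‖ * ‖Φ‖ ≤ 1 := h2 ▸ h3
  change ‖Φ‖ ≤ 1
  nlinarith [norm_nonneg Φ]

end MatrixNorms

theorem transpose_mul_self_of_mem_orthogonalGroup {N : ℕ} {Φ : Matrix (Fin N) (Fin N) ℝ}
    (hΦ : Φ ∈ Matrix.orthogonalGroup (Fin N) ℝ) : Φ.transpose * Φ = 1 := by
  rw [← Matrix.conjTranspose_eq_transpose_of_trivial]
  exact Matrix.mem_unitaryGroup_iff'.1 hΦ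

theorem opNorm_mul_orthogonal_le {n N : ℕ} (A : Matrix (Fin n) (Fin N) ℝ)
    {Φ : Matrix (Fin N) (Fin N) ℝ} (hΦ : Φ ∈ Matrix.orthogonalGroup (Fin N) ℝ) :
    opNorm (A * Φ) ≤ opNorm A :=
  (opNorm_mul_le A Φ).trans
    (mul_le_of_le_one_right (opNorm_nonneg A) (opNorm_le_one_of_mem_orthogonalGroup hΦ))

theorem contractionFactor_nonneg {n N : ℕ} (A : Matrix (Fin n) (Fin N) ℝ) (τ : ℝ) :
    0 ≤ contractionFactor A τ := opNorm_nonneg _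

/-- The contraction factor does not increase when `A` is multiplied by an orthogonal matrix. -/
theorem opNorm_one_sub_le_contractionFactor {n N : ℕ} (A : Matrix (Fin n) (Fin N) ℝ) (τ : ℝ)
    {Φ : Matrix (Fin N) (Fin N) ℝ} (hΦ : Φ ∈ Matrix.orthogonalGroup (Fin N) ℝ) :
    opNorm (1 - τ • ((A * Φ).transpose * (A * Φ))) ≤ contractionFactor A τ := by
  have h : 1 - τ • ((A * Φ).transpose * (A * Φ))
      = Φ.transpose * (1 - τ • (A.transpose * A)) * Φ := by
    rw [mul_sub, sub_mul, mul_one, transpose_mul_self_of_mem_orthogonalGroup hΦ,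
      Matrix.mul_smul, Matrix.smul_mul, Matrix.transpose_mul]
    simp only [Matrix.mul_assoc]
  have hΦ1 := opNorm_le_one_of_mem_orthogonalGroup hΦ
  have h0 := contractionFactor_nonneg A τ
  rw [h]
  calc _ ≤ opNorm (Φ.transpose * (1 - τ • (A.transpose * A))) * opNorm Φ := opNorm_mul_le _ _
    _ ≤ opNorm Φ.transpose * contractionFactor A τ * opNorm Φ :=
        mul_le_mul_of_nonneg_right (opNorm_mul_le _ _) (opNorm_nonneg _)
    _ ≤ 1 * contractionFactor A τ * 1 := by
        rw [opNorm_transpose]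
        gcongr
        exact opNorm_nonneg _
    _ = contractionFactor A τ := by ring

section MulE

variable {p q r : ℕ}

theorem mulE_sub (M : Matrix (Fin p) (Fin q) ℝ) (v w : Vec q) :
    mulE M (v - w) = mulE M v - mulE M w := by
  ext i; simp [mulE, Matrix.mulVec_sub]

theorem sub_mulE (M M' : Matrix (Fin p) (Fin q) ℝ) (v : Vec q) :
    mulE (M - M') v = mulE M v - mulE M' v := by
  ext i; simp [mulE, Matrix.sub_mulVec]

theorem smul_mulE (c : ℝ) (M : Matrix (Fin p) (Fin q) ℝ) (v : Vec q) :
    mulE (c • M) v = c • mulE M v := by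
  ext i; simp [mulE, Matrix.smul_mulVec]

theorem one_mulE (v : Vec q) : mulE 1 v = v := by
  ext i; simp [mulE]

theorem mul_mulE (M : Matrix (Fin p) (Fin q) ℝ) (M' : Matrix (Fin q) (Fin r) ℝ) (v : Vec r) :
    mulE (M * M') v = mulE M (mulE M' v) := by
  ext i; simp [mulE]

theorem continuous_mulE :
    Continuous fun x : Matrix (Fin p) (Fin q) ℝ × Vec q => mulE x.1 x.2 := by
  unfold mulE
  fun_prop

end MulE

section Shrink

theorem abs_shrink_sub_shrink_le {lam : ℝ} (hlam : 0 ≤ lam) (x y : ℝ) :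
    |shrink lam x - shrink lam y| ≤ |x - y| := by
  have key : ∀ z : ℝ, (|z| ≤ lam ∧ shrink lam z = 0) ∨ (lam < z ∧ shrink lam z = z - lam) ∨
      (z < -lam ∧ shrink lam z = z + lam) := fun z => by
    unfold shrink
    by_cases h : |z| ≤ lam
    · exact Or.inl ⟨h, if_pos h⟩
    · right
      rw [if_neg h]
      rcases lt_abs.1 (not_le.1 h) with h1 | h1
      · exact Or.inl ⟨h1, by rw [Real.sign_of_pos (by linarith)]; ring⟩
      · exact Or.inr ⟨by linarith, by rw [Real.sign_of_neg (by linarith)]; ring⟩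
  rcases key x with ⟨hx, ex⟩ | ⟨hx, ex⟩ | ⟨hx, ex⟩ <;>
  rcases key y with ⟨hy, ey⟩ | ⟨hy, ey⟩ | ⟨hy, ey⟩ <;>
  rw [ex, ey] <;> (try rw [abs_le] at hx) <;> (try rw [abs_le] at hy) <;>
  rw [abs_le] <;> constructor <;> cases abs_cases (x - y) <;> linarith

variable {d : ℕ}

theorem norm_le_norm_of_abs_le {v w : Vec d} (h : ∀ i, |v i| ≤ |w i|) : ‖v‖ ≤ ‖w‖ := by
  rw [EuclideanSpace.norm_eq, EuclideanSpace.norm_eq]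
  refine Real.sqrt_le_sqrt (Finset.sum_le_sum fun i _ => ?_)
  simp only [Real.norm_eq_abs]
  exact pow_le_pow_left₀ (abs_nonneg _) (h i) 2

theorem norm_shrinkVec_sub_le {lam : ℝ} (hlam : 0 ≤ lam) (v w : Vec d) :
    ‖shrinkVec lam v - shrinkVec lam w‖ ≤ ‖v - w‖ :=
  norm_le_norm_of_abs_le fun i => abs_shrink_sub_shrink_le hlam (v i) (w i)

theorem shrinkVec_zero {lam : ℝ} (hlam : 0 ≤ lam) : shrinkVec lam (0 : Vec d) = 0 := by
  ext i
  simp [shrinkVec, shrink, hlam]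

theorem norm_shrinkVec_le {lam : ℝ} (hlam : 0 ≤ lam) (v : Vec d) :
    ‖shrinkVec lam v‖ ≤ ‖v‖ := by
  simpa [shrinkVec_zero hlam] using norm_shrinkVec_sub_le hlam v 0

theorem continuous_shrinkVec {lam : ℝ} (hlam : 0 ≤ lam) :
    Continuous (shrinkVec lam : Vec d → Vec d) :=
  (LipschitzWith.of_dist_le_mul (K := 1) fun v w => by
    simpa [dist_eq_norm] using norm_shrinkVec_sub_le hlam v w).continuous

end Shrink

section Clip

variable {N : ℕ} {B : ℝ}

theorem norm_clip_le (hB : 0 < B) (x : Vec N) : ‖clip B x‖ ≤ B := by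
  unfold clip
  split_ifs with h
  · exact h
  · have hx : 0 < ‖x‖ := hB.trans (not_le.1 h)
    rw [norm_smul, Real.norm_of_nonneg (by positivity), div_mul_cancel₀ _ (ne_of_gt hx)]

/-- The variational characterisation of the projection onto the ball. -/
theorem inner_sub_clip_le (hB : 0 < B) (x : Vec N) {w : Vec N} (hw : ‖w‖ ≤ B) :
    inner ℝ (x - clip B x) (w - clip B x) ≤ 0 := by
  unfold clip
  split_ifs with h
  · simp
  · have hx : B < ‖x‖ := not_le.1 h
    have hx0 : 0 < ‖x‖ := hB.trans hx
    have h1 : x - (B / ‖x‖) • x = (1 - B / ‖x‖) • x := by rw [sub_smul, one_smul]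
    rw [h1, real_inner_smul_left]
    refine mul_nonpos_of_nonneg_of_nonpos ?_ ?_
    · rw [sub_nonneg, div_le_one hx0]; exact hx.le
    · rw [inner_sub_right, real_inner_smul_right, real_inner_self_eq_norm_sq]
      have h2 : B / ‖x‖ * ‖x‖ ^ 2 = ‖x‖ * B := by field_simp
      have h3 := (real_inner_le_norm x w).trans (mul_le_mul_of_nonneg_left hw hx0.le)
      rw [h2]
      linarith

/-- Projections onto convex sets are nonexpansive: adding the variational inequalities at `x` and
`y` gives `‖u - v‖ ^ 2 ≤ inner ℝ (x - y) (u - v)`, and Cauchy–Schwarz concludes. -/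
theorem norm_clip_sub_clip_le (hB : 0 < B) (x y : Vec N) :
    ‖clip B x - clip B y‖ ≤ ‖x - y‖ := by
  have h1 := inner_sub_clip_le hB x (norm_clip_le hB y)
  have h2 := inner_sub_clip_le hB y (norm_clip_le hB x)
  set u := clip B x
  set v := clip B y
  have h3 : ‖u - v‖ ^ 2 = inner ℝ (x - y) (u - v) + inner ℝ (x - u) (v - u)
      + inner ℝ (y - v) (u - v) := by
    rw [← real_inner_self_eq_norm_sq, ← neg_sub u v, inner_neg_right, ← sub_eq_add_neg,
      ← inner_sub_left, ← inner_add_left]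
    congr 1
    abel
  have h4 := real_inner_le_norm (x - y) (u - v)
  by_contra! hcon
  nlinarith [norm_nonneg (x - y)]

theorem continuous_clip (hB : 0 < B) : Continuous (clip B : Vec N → Vec N) :=
  (LipschitzWith.of_dist_le_mul (K := 1) fun v w => by
    simpa [dist_eq_norm] using norm_clip_sub_clip_le hB v w).continuous

end Clip

section Perturbation

variable {n N : ℕ}

/-- The geometric sum `1 + a + ⋯ + a^(l-1)` of the contraction factor. -/
def geomSum (A : Matrix (Fin n) (Fin N) ℝ) (τ : ℝ) (l : ℕ) : ℝ :=
  ∑ k ∈ Finset.range l, contractionFactor A τ ^ k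

/-- The Lipschitz constant of `Φ ↦ f_Φ^l(y)` for `‖y‖ = 1`, by recursion. -/
def lipConst (A : Matrix (Fin n) (Fin N) ℝ) (τ : ℝ) : ℕ → ℝ
  | 0 => 0
  | l + 1 => contractionFactor A τ * lipConst A τ l
      + τ * (1 + 2 * τ * opNorm A ^ 2 * geomSum A τ l)

theorem geomSum_nonneg (A : Matrix (Fin n) (Fin N) ℝ) (τ : ℝ) (l : ℕ) : 0 ≤ geomSum A τ l :=
  Finset.sum_nonneg fun _ _ => pow_nonneg (contractionFactor_nonneg A τ) _

theorem geomSum_succ (A : Matrix (Fin n) (Fin N) ℝ) (τ : ℝ) (l : ℕ) :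
    geomSum A τ (l + 1) = contractionFactor A τ * geomSum A τ l + 1 := by
  rw [geomSum, geom_sum_succ, geomSum]

theorem lipConst_nonneg (A : Matrix (Fin n) (Fin N) ℝ) {τ : ℝ} (hτ : 0 ≤ τ) (l : ℕ) :
    0 ≤ lipConst A τ l := by
  induction l with
  | zero => simp [lipConst]
  | succ l ih =>
    have h1 := contractionFactor_nonneg A τ
    have h2 := geomSum_nonneg A τ l
    have h3 := opNorm_nonneg A
    unfold lipConst
    positivity

/-- Isolates the linear action on `z`, whose norm is at most the contraction factor. -/
theorem layer_eq (A : Matrix (Fin n) (Fin N) ℝ) (τ lam : ℝ) (Φ : Matrix (Fin N) (Fin N) ℝ)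
    (y : Vec n) (z : Vec N) : layer A τ lam Φ y z = shrinkVec (τ * lam)
      (mulE (1 - τ • ((A * Φ).transpose * (A * Φ))) z + τ • mulE (A * Φ).transpose y) := by
  rw [layer, sub_mulE, one_mulE, smul_mulE, mul_mulE (A * Φ).transpose, mulE_sub, smul_sub]
  congr 1
  abel

theorem norm_network_le (A : Matrix (Fin n) (Fin N) ℝ) {τ lam : ℝ} (hτ : 0 ≤ τ) (hlam : 0 ≤ lam)
    {Φ : Matrix (Fin N) (Fin N) ℝ} (hΦ : Φ ∈ Matrix.orthogonalGroup (Fin N) ℝ) (l : ℕ)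
    (y : Vec n) : ‖network A τ lam Φ l y‖ ≤ τ * opNorm A * geomSum A τ l * ‖y‖ := by
  induction l with
  | zero => simp [network, geomSum]
  | succ l ih =>
    rw [network, layer_eq]
    refine (norm_shrinkVec_le (mul_nonneg hτ hlam) _).trans ((norm_add_le _ _).trans ?_)
    have h1 := (norm_mulE_le _ (network A τ lam Φ l y)).trans
      (mul_le_mul (opNorm_one_sub_le_contractionFactor A τ hΦ) ih (norm_nonneg _)
        (contractionFactor_nonneg A τ))
    have h2 : ‖τ • mulE (A * Φ).transpose y‖ ≤ τ * (opNorm A * ‖y‖) := by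
      rw [norm_smul, Real.norm_of_nonneg hτ]
      gcongr
      refine (norm_mulE_le _ y).trans ?_
      rw [opNorm_transpose]
      gcongr
      exact opNorm_mul_orthogonal_le A hΦ
    rw [geomSum_succ]
    refine (add_le_add h1 h2).trans (le_of_eq ?_)
    ring

theorem opNorm_gram_sub_le {p q : ℕ} (M M' : Matrix (Fin p) (Fin q) ℝ) {R : ℝ}
    (hM : opNorm M ≤ R) (hM' : opNorm M' ≤ R) :
    opNorm (M.transpose * M - M'.transpose * M') ≤ 2 * R * opNorm (M - M') := by
  have h : M.transpose * M - M'.transpose * M'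
      = M.transpose * (M - M') + (M - M').transpose * M' := by
    rw [Matrix.transpose_sub, Matrix.mul_sub, Matrix.sub_mul]
    abel
  rw [h]
  refine (opNorm_add_le _ _).trans ?_
  have h1 := opNorm_mul_le M.transpose (M - M')
  have h2 := opNorm_mul_le (M - M').transpose M'
  rw [opNorm_transpose] at h1 h2
  have h3 := mul_le_mul_of_nonneg_right hM (opNorm_nonneg (M - M'))
  have h4 := mul_le_mul_of_nonneg_left hM' (opNorm_nonneg (M - M'))
  linarith

/-- Perturbation of the dictionary. -/
theorem norm_network_sub_le (A : Matrix (Fin n) (Fin N) ℝ) {τ lam : ℝ} (hτ : 0 ≤ τ)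
    (hlam : 0 ≤ lam) {Φ Φ' : Matrix (Fin N) (Fin N) ℝ}
    (hΦ : Φ ∈ Matrix.orthogonalGroup (Fin N) ℝ) (hΦ' : Φ' ∈ Matrix.orthogonalGroup (Fin N) ℝ)
    (l : ℕ) (y : Vec n) : ‖network A τ lam Φ l y - network A τ lam Φ' l y‖
      ≤ lipConst A τ l * opNorm (A * Φ - A * Φ') * ‖y‖ := by
  induction l with
  | zero => simp [network, lipConst]
  | succ l ih =>
    simp only [network, layer_eq]
    refine (norm_shrinkVec_sub_le (mul_nonneg hτ hlam) _ _).trans ?_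
    set z := network A τ lam Φ l y with hz
    set z' := network A τ lam Φ' l y with hz'
    set B := A * Φ with hB
    set B' := A * Φ' with hB'
    -- Three sources of error: the propagated difference `z - z'`, the changed Gram matrix acting on
    -- `z` (controlled by `norm_network_le`), and the changed input. They produce the three terms in
    -- the recursion for `lipConst`.
    have hdec : mulE (1 - τ • (B.transpose * B)) z + τ • mulE B.transpose y
        - (mulE (1 - τ • (B'.transpose * B')) z' + τ • mulE B'.transpose y)
        = mulE (1 - τ • (B'.transpose * B')) (z - z')
          - τ • mulE (B.transpose * B - B'.transpose * B') z
          + τ • mulE (B - B').transpose y := by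
      rw [mulE_sub, sub_mulE (B.transpose * B), Matrix.transpose_sub, sub_mulE B.transpose,
        sub_mulE 1 _ z, smul_mulE, one_mulE, sub_mulE 1 _ z, smul_mulE, one_mulE, smul_sub,
        smul_sub]
      abel
    rw [hdec]
    have hBn := opNorm_mul_orthogonal_le A hΦ
    have hBn' := opNorm_mul_orthogonal_le A hΦ'
    have h1 : ‖mulE (1 - τ • (B'.transpose * B')) (z - z')‖
        ≤ contractionFactor A τ * (lipConst A τ l * opNorm (B - B') * ‖y‖) :=
      (norm_mulE_le _ _).trans (mul_le_mul (opNorm_one_sub_le_contractionFactor A τ hΦ') ih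
        (norm_nonneg _) (contractionFactor_nonneg A τ))
    have h2 : ‖τ • mulE (B.transpose * B - B'.transpose * B') z‖
        ≤ τ * (2 * opNorm A * opNorm (B - B') * (τ * opNorm A * geomSum A τ l * ‖y‖)) := by
      rw [norm_smul, Real.norm_of_nonneg hτ]
      refine mul_le_mul_of_nonneg_left ((norm_mulE_le _ _).trans ?_) hτ
      exact mul_le_mul (opNorm_gram_sub_le B B' hBn hBn') (norm_network_le A hτ hlam hΦ l y)
        (norm_nonneg _) (mul_nonneg (mul_nonneg zero_le_two (opNorm_nonneg A)) (opNorm_nonneg _))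
    have h3 : ‖τ • mulE (B - B').transpose y‖ ≤ τ * (opNorm (B - B') * ‖y‖) := by
      rw [norm_smul, Real.norm_of_nonneg hτ, ← opNorm_transpose (B - B')]
      exact mul_le_mul_of_nonneg_left (norm_mulE_le _ _) hτ
    refine (norm_add_le _ _).trans ((add_le_add (norm_sub_le _ _) le_rfl).trans ?_)
    refine (add_le_add (add_le_add h1 h2) h3).trans (le_of_eq ?_)
    rw [lipConst]
    ring

theorem constM_eq {m : ℕ} (A : Matrix (Fin n) (Fin N) ℝ) (τ : ℝ) (L : ℕ)
    (Y : Matrix (Fin n) (Fin m) ℝ) :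
    constM A τ L Y = τ * opNorm A * geomSum A τ L * frobNorm Y := by
  rw [constM, geomSum]
  ring

/-- The closed form solves the recursion: the `l`-th summand is the error created in layer `l`,
damped by the `L - l` later layers. Layer `1` starts from zero and contributes only `τ`. -/
theorem constK_eq {m : ℕ} (A : Matrix (Fin n) (Fin N) ℝ) (τ : ℝ) {L : ℕ} (hL : 1 ≤ L)
    (Y : Matrix (Fin n) (Fin m) ℝ) : constK A τ L Y = lipConst A τ L * frobNorm Y := by
  induction L, hL using Nat.le_induction with
  | base => simp [constK, lipConst, geomSum]
  | succ L hL ih =>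
    rw [lipConst, add_mul, mul_assoc, ← ih, constK, constK,
      Finset.sum_Icc_succ_top (by omega), Nat.sub_self, pow_zero, one_mul, Nat.add_sub_cancel]
    have h1 : ∀ l ∈ Finset.Icc 2 L, contractionFactor A τ ^ (L + 1 - l) *
        (1 + 2 * τ * opNorm A ^ 2 * ∑ k ∈ Finset.range (l - 1), contractionFactor A τ ^ k)
        = contractionFactor A τ * (contractionFactor A τ ^ (L - l) *
        (1 + 2 * τ * opNorm A ^ 2 * ∑ k ∈ Finset.range (l - 1), contractionFactor A τ ^ k)) :=
      fun l hl => by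
        rw [Nat.sub_add_comm (Finset.mem_Icc.1 hl).2, pow_succ]
        ring
    have h2 : contractionFactor A τ ^ L
        = contractionFactor A τ * contractionFactor A τ ^ (L - 1) := by
      rw [← pow_succ', Nat.sub_add_cancel hL]
    rw [Finset.sum_congr rfl h1, ← Finset.mul_sum, h2, geomSum]
    ring

section

open scoped Matrix.Norms.Frobenius

theorem frobNorm_nonneg {p q : ℕ} (M : Matrix (Fin p) (Fin q) ℝ) : 0 ≤ frobNorm M := norm_nonneg M

end

theorem constK_nonneg {m : ℕ} (A : Matrix (Fin n) (Fin N) ℝ) {τ : ℝ} (hτ : 0 ≤ τ) {L : ℕ}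
    (hL : 1 ≤ L) (Y : Matrix (Fin n) (Fin m) ℝ) : 0 ≤ constK A τ L Y := by
  rw [constK_eq A τ hL]
  exact mul_nonneg (lipConst_nonneg A hτ L) (frobNorm_nonneg Y)

theorem constM_nonneg {m : ℕ} (A : Matrix (Fin n) (Fin N) ℝ) {τ : ℝ} (hτ : 0 ≤ τ) (L : ℕ)
    (Y : Matrix (Fin n) (Fin m) ℝ) : 0 ≤ constM A τ L Y := by
  rw [constM_eq]
  exact mul_nonneg (mul_nonneg (mul_nonneg hτ (opNorm_nonneg A)) (geomSum_nonneg A τ L))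
    (frobNorm_nonneg Y)

end Perturbation

section Hypothesis

variable {n N : ℕ}

/-- The hypothesis with parameters `Ψ` and `Φ`. -/
def hypothesis (A : Matrix (Fin n) (Fin N) ℝ) (τ lam B : ℝ) (L : ℕ)
    (Ψ Φ : Matrix (Fin N) (Fin N) ℝ) (y : Vec n) : Vec N :=
  clip B (mulE Ψ (network A τ lam Φ L y))

theorem norm_hypothesis_sub_le (A : Matrix (Fin n) (Fin N) ℝ) {τ lam B : ℝ} (hτ : 0 ≤ τ)
    (hlam : 0 ≤ lam) (hB : 0 < B) (L : ℕ) {Ψ Ψ' Φ Φ' : Matrix (Fin N) (Fin N) ℝ}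
    (hΨ' : Ψ' ∈ Matrix.orthogonalGroup (Fin N) ℝ)
    (hΦ : Φ ∈ Matrix.orthogonalGroup (Fin N) ℝ) (hΦ' : Φ' ∈ Matrix.orthogonalGroup (Fin N) ℝ)
    (y : Vec n) : ‖hypothesis A τ lam B L Ψ Φ y - hypothesis A τ lam B L Ψ' Φ' y‖
      ≤ (lipConst A τ L * opNorm (A * Φ - A * Φ')
        + τ * opNorm A * geomSum A τ L * opNorm (Ψ - Ψ')) * ‖y‖ := by
  refine (norm_clip_sub_clip_le hB _ _).trans ?_
  set f := network A τ lam Φ L y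
  set f' := network A τ lam Φ' L y
  have hdec : mulE Ψ f - mulE Ψ' f' = mulE (Ψ - Ψ') f + mulE Ψ' (f - f') := by
    rw [sub_mulE, mulE_sub]
    abel
  rw [hdec]
  have h1 := (norm_mulE_le (Ψ - Ψ') f).trans
    (mul_le_mul_of_nonneg_left (norm_network_le A hτ hlam hΦ L y) (opNorm_nonneg _))
  have h2 := (norm_mulE_le Ψ' (f - f')).trans (mul_le_of_le_one_left (norm_nonneg _)
    (opNorm_le_one_of_mem_orthogonalGroup hΨ'))
  have h3 := norm_network_sub_le A hτ hlam hΦ hΦ' L y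
  refine (norm_add_le _ _).trans ((add_le_add h1 (h2.trans h3)).trans (le_of_eq ?_))
  ring

theorem continuous_network (A : Matrix (Fin n) (Fin N) ℝ) {τ lam : ℝ} (hτ : 0 ≤ τ)
    (hlam : 0 ≤ lam) (L : ℕ) :
    Continuous fun p : Matrix (Fin N) (Fin N) ℝ × Vec n => network A τ lam p.1 L p.2 := by
  induction L with
  | zero => exact continuous_const
  | succ l ih =>
    refine (continuous_shrinkVec (mul_nonneg hτ hlam)).comp (ih.add (Continuous.const_smul ?_ τ))
    refine continuous_mulE.comp (Continuous.prodMk (by fun_prop) (continuous_snd.sub ?_))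
    exact continuous_mulE.comp (Continuous.prodMk (by fun_prop) ih)

theorem continuous_hypothesis (A : Matrix (Fin n) (Fin N) ℝ) {τ lam B : ℝ} (hτ : 0 ≤ τ)
    (hlam : 0 ≤ lam) (hB : 0 < B) (L : ℕ) :
    Continuous fun p : (Matrix (Fin N) (Fin N) ℝ × Matrix (Fin N) (Fin N) ℝ) × Vec n =>
      hypothesis A τ lam B L p.1.1 p.1.2 p.2 := by
  refine (continuous_clip hB).comp (continuous_mulE.comp
    (Continuous.prodMk (by fun_prop) ?_))
  exact (continuous_network A hτ hlam L).comp (Continuous.prodMk (by fun_prop) (by fun_prop))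

theorem frobNorm_measurements {m : ℕ} (A : Matrix (Fin n) (Fin N) ℝ) (x : Fin m → Vec N) :
    frobNorm (measurements A x) = √(∑ j, ‖mulE A (x j)‖ ^ 2) := by
  rw [frobNorm, Matrix.frobenius_norm_def, Finset.sum_comm, ← Real.sqrt_eq_rpow]
  congr 1
  refine Finset.sum_congr rfl fun j _ => ?_
  rw [EuclideanSpace.norm_sq_eq]
  simp [measurements]

end Hypothesis

end Network

end LISTA

namespace LISTA

open MeasureTheory Module

/-! ### Truncated losses and the uniform generalization bound -/

noncomputable section Generalization

variable {n N m : ℕ}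

/-- The parameter space `O(N) × O(N)` of the hypothesis class. -/
abbrev Param (N : ℕ) : Type :=
  {p : Matrix (Fin N) (Fin N) ℝ × Matrix (Fin N) (Fin N) ℝ //
    p.1 ∈ Matrix.orthogonalGroup (Fin N) ℝ ∧ p.2 ∈ Matrix.orthogonalGroup (Fin N) ℝ}

/-- The loss of a hypothesis at a signal `x`, truncated at the level `c`. -/
def truncLoss (A : Matrix (Fin n) (Fin N) ℝ) (τ lam B c : ℝ) (L : ℕ) (θ : Param N)
    (x : Vec N) : ℝ :=
  min (loss (hypothesis A τ lam B L θ.1.1 θ.1.2) x (mulE A x)) c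

theorem continuous_truncLoss (A : Matrix (Fin n) (Fin N) ℝ) {τ lam B : ℝ} (c : ℝ) (hτ : 0 ≤ τ)
    (hlam : 0 ≤ lam) (hB : 0 < B) (L : ℕ) :
    Continuous fun p : Param N × Vec N => truncLoss A τ lam B c L p.1 p.2 := by
  have hA : Continuous fun p : Param N × Vec N => mulE A p.2 :=
    continuous_mulE.comp (continuous_const.prodMk continuous_snd)
  have h : Continuous fun p : Param N × Vec N =>
      hypothesis A τ lam B L p.1.1.1 p.1.1.2 (mulE A p.2) :=
    Continuous.comp (f := fun p : Param N × Vec N => (p.1.1, mulE A p.2))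
      (continuous_hypothesis A hτ hlam hB L)
      ((continuous_subtype_val.comp continuous_fst).prodMk hA)
  exact (h.sub continuous_snd).norm.min continuous_const

theorem continuous_truncLoss_signal (A : Matrix (Fin n) (Fin N) ℝ) {τ lam B : ℝ} (c : ℝ)
    (hτ : 0 ≤ τ) (hlam : 0 ≤ lam) (hB : 0 < B) (L : ℕ) (θ : Param N) :
    Continuous (truncLoss A τ lam B c L θ) :=
  Continuous.comp (f := fun x : Vec N => (θ, x)) (continuous_truncLoss A c hτ hlam hB L)
    (continuous_const.prodMk continuous_id)

theorem continuous_truncLoss_param (A : Matrix (Fin n) (Fin N) ℝ) {τ lam B : ℝ} (c : ℝ)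
    (hτ : 0 ≤ τ) (hlam : 0 ≤ lam) (hB : 0 < B) (L : ℕ) (x : Vec N) :
    Continuous fun θ => truncLoss A τ lam B c L θ x :=
  Continuous.comp (f := fun θ : Param N => (θ, x)) (continuous_truncLoss A c hτ hlam hB L)
    (continuous_id.prodMk continuous_const)

theorem truncLoss_nonneg (A : Matrix (Fin n) (Fin N) ℝ) (τ lam B : ℝ) {c : ℝ} (hc : 0 ≤ c)
    (L : ℕ) (θ : Param N) (x : Vec N) : 0 ≤ truncLoss A τ lam B c L θ x :=
  le_min (norm_nonneg _) hc

theorem truncLoss_le (A : Matrix (Fin n) (Fin N) ℝ) (τ lam B c : ℝ) (L : ℕ) (θ : Param N)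
    (x : Vec N) : truncLoss A τ lam B c L θ x ≤ c := min_le_right _ _

theorem truncLoss_eq (A : Matrix (Fin n) (Fin N) ℝ) {τ lam B Bin : ℝ} (hB : 0 < B) (L : ℕ)
    (θ : Param N) {x : Vec N} (hx : ‖x‖ ≤ Bin) : truncLoss A τ lam B (Bin + B) L θ x
      = loss (hypothesis A τ lam B L θ.1.1 θ.1.2) x (mulE A x) := by
  refine min_eq_left ((norm_sub_le _ _).trans ?_)
  rw [add_comm]
  exact add_le_add hx (norm_clip_le hB _)

theorem abs_min_norm_sub_le {E : Type*} [SeminormedAddCommGroup E] (u v x : E) (c : ℝ) :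
    |min ‖u - x‖ c - min ‖v - x‖ c| ≤ ‖u - v‖ := by
  refine (abs_min_sub_min_le_max _ _ _ _).trans ?_
  rw [sub_self, abs_zero, max_eq_left (abs_nonneg _)]
  refine (abs_norm_sub_norm_le _ _).trans (le_of_eq ?_)
  rw [sub_sub_sub_cancel_right]

theorem abs_truncLoss_sub_le (A : Matrix (Fin n) (Fin N) ℝ) (τ lam B c : ℝ) (L : ℕ)
    (θ θ' : Param N) (x : Vec N) :
    |truncLoss A τ lam B c L θ x - truncLoss A τ lam B c L θ' x|
      ≤ ‖hypothesis A τ lam B L θ.1.1 θ.1.2 (mulE A x)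
        - hypothesis A τ lam B L θ'.1.1 θ'.1.2 (mulE A x)‖ := by
  unfold truncLoss loss
  exact abs_min_norm_sub_le _ _ _ _

/-- Centring at the loss of the zero hypothesis gives the chaining radius `√m * B`, free of `Bin`.
-/
theorem abs_truncLoss_sub_min_norm_le (A : Matrix (Fin n) (Fin N) ℝ) (τ lam c : ℝ) {B : ℝ}
    (hB : 0 < B) (L : ℕ) (θ : Param N) (x : Vec N) :
    |truncLoss A τ lam B c L θ x - min ‖(0 : Vec N) - x‖ c| ≤ B := by
  unfold truncLoss loss
  refine (abs_min_norm_sub_le _ _ _ _).trans ?_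
  rw [sub_zero]
  exact norm_clip_le hB _

theorem norm_sampleVec_sub_le_of_le {X : Type*} (f g : X → ℝ) (x : Fin m → X) {b : Fin m → ℝ}
    (h : ∀ j, |f (x j) - g (x j)| ≤ b j) :
    ‖sampleVec f x - sampleVec g x‖ ≤ √(∑ j, b j ^ 2) := by
  rw [EuclideanSpace.norm_eq]
  refine Real.sqrt_le_sqrt (Finset.sum_le_sum fun j _ => ?_)
  exact pow_le_pow_left₀ (norm_nonneg _) (h j) 2

theorem norm_sampleVec_truncLoss_sub_le (A : Matrix (Fin n) (Fin N) ℝ) {τ lam B : ℝ} (c : ℝ)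
    (hτ : 0 ≤ τ) (hlam : 0 ≤ lam) (hB : 0 < B) {L : ℕ} (hL : 1 ≤ L) (x : Fin m → Vec N)
    (θ θ' : Param N) :
    ‖sampleVec (truncLoss A τ lam B c L θ) x - sampleVec (truncLoss A τ lam B c L θ') x‖
      ≤ constK A τ L (measurements A x) * opNorm (A * θ.1.2 - A * θ'.1.2)
        + constM A τ L (measurements A x) * opNorm (θ.1.1 - θ'.1.1) := by
  set s := lipConst A τ L * opNorm (A * θ.1.2 - A * θ'.1.2)
        + τ * opNorm A * geomSum A τ L * opNorm (θ.1.1 - θ'.1.1) with hs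
  have hs0 : 0 ≤ s := by
    have h1 := lipConst_nonneg A hτ L
    have h2 := geomSum_nonneg A τ L
    have h3 := opNorm_nonneg A
    have h4 := opNorm_nonneg (A * θ.1.2 - A * θ'.1.2)
    have h5 := opNorm_nonneg (θ.1.1 - θ'.1.1)
    positivity
  have hj : ∀ j, |truncLoss A τ lam B c L θ (x j) - truncLoss A τ lam B c L θ' (x j)|
      ≤ s * ‖mulE A (x j)‖ := fun j => (abs_truncLoss_sub_le A τ lam B c L θ θ' (x j)).trans
    (norm_hypothesis_sub_le A hτ hlam hB L θ'.2.1 θ.2.2 θ'.2.2 _)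
  refine (norm_sampleVec_sub_le_of_le _ _ x hj).trans (le_of_eq ?_)
  simp only [mul_pow]
  rw [← Finset.mul_sum, Real.sqrt_mul (by positivity), Real.sqrt_sq hs0,
    ← frobNorm_measurements, constK_eq A τ hL, constM_eq, hs]
  ring

section

open scoped Matrix.Norms.L2Operator

/-- Nets for the loss vectors, from nets of the two parameters. -/
theorem exists_net_truncLoss (A : Matrix (Fin n) (Fin N) ℝ) {τ lam B : ℝ} (c : ℝ)
    (hτ : 0 ≤ τ) (hlam : 0 ≤ lam) (hB : 0 < B) {L : ℕ} (hL : 1 ≤ L) (x : Fin m → Vec N)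
    {ε : ℝ} (hε : 0 < ε) :
    ∃ T : Finset (Vec m),
      (T : Set (Vec m)) ⊆ Set.range (fun θ => sampleVec (truncLoss A τ lam B c L θ) x) ∧
      (T.card : ℝ) ≤ (1 + 4 * (constK A τ L (measurements A x) * opNorm A) / ε) ^ (N * n) *
        (1 + 4 * constM A τ L (measurements A x) / ε) ^ (N * N) ∧
      ∀ v ∈ Set.range (fun θ => sampleVec (truncLoss A τ lam B c L θ) x),
        ∃ t ∈ T, dist v t ≤ ε := by
  classical
  set K := constK A τ L (measurements A x) with hK
  set M := constM A τ L (measurements A x) with hM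
  have hK0 : 0 ≤ K := constK_nonneg A hτ hL _
  have hM0 : 0 ≤ M := constM_nonneg A hτ L _
  -- The net lives among the products `A * Φ`, of dimension `n * N`, not among the `Φ`. Being
  -- internal, it lifts back to orthogonal matrices `φ`. Each parameter is allotted half of `ε`.
  obtain ⟨T₁, hT₁, hc₁, hn₁⟩ := exists_net_scaled
    (Set.range fun Φ : Matrix.orthogonalGroup (Fin N) ℝ => A * Φ.1) (R := opNorm A)
    (ε := ε / 2) (K := K) (by positivity) hK0
    (by rintro _ ⟨Φ, rfl⟩; exact opNorm_mul_orthogonal_le A Φ.2) (Set.range_nonempty _)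
  obtain ⟨T₂, hT₂, hc₂, hn₂⟩ := exists_net_scaled
    (Matrix.orthogonalGroup (Fin N) ℝ : Set (Matrix (Fin N) (Fin N) ℝ)) (R := 1)
    (ε := ε / 2) (K := M) (by positivity) hM0
    (fun Ψ hΨ => opNorm_le_one_of_mem_orthogonalGroup hΨ) ⟨1, one_mem _⟩
  choose φ hφ using fun t : T₁ => hT₁ t.2
  let F : T₂ × T₁ → Vec m := fun p =>
    sampleVec (truncLoss A τ lam B c L ⟨(p.1.1, (φ p.2).1), hT₂ p.1.2, (φ p.2).2⟩) x
  refine ⟨Finset.univ.image F, ?_, ?_, ?_⟩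
  · intro v hv
    simp only [Finset.coe_image, Finset.coe_univ, Set.image_univ] at hv
    obtain ⟨p, rfl⟩ := hv
    exact ⟨_, rfl⟩
  · have h1 : ((Finset.univ.image F).card : ℝ) ≤ T₁.card * T₂.card := by
      have := Finset.card_image_le (s := Finset.univ) (f := F)
      rw [Finset.card_univ, Fintype.card_prod, Fintype.card_coe, Fintype.card_coe,
        mul_comm] at this
      exact_mod_cast this
    refine h1.trans (mul_le_mul (hc₁.trans (le_of_eq ?_)) (hc₂.trans (le_of_eq ?_))
      (by positivity) ?_)
    · rw [Module.finrank_matrix, Module.finrank_self, Fintype.card_fin, Fintype.card_fin,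
        mul_one, mul_comm n N]
      congr 2
      field_simp
      ring
    · rw [Module.finrank_matrix, Module.finrank_self, Fintype.card_fin, mul_one]
      congr 1
      · field_simp
        ring
      · rw [mul_one]
    · have := opNorm_nonneg A
      positivity
  · rintro _ ⟨θ, rfl⟩
    obtain ⟨t₁, ht₁, hd₁⟩ := hn₁ _ ⟨⟨θ.1.2, θ.2.2⟩, rfl⟩
    obtain ⟨t₂, ht₂, hd₂⟩ := hn₂ _ θ.2.1
    refine ⟨F (⟨t₂, ht₂⟩, ⟨t₁, ht₁⟩), Finset.mem_image_of_mem _ (Finset.mem_univ _), ?_⟩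
    rw [dist_eq_norm]
    refine (norm_sampleVec_truncLoss_sub_le A c hτ hlam hB hL x _ _).trans ?_
    have h1 := hφ ⟨t₁, ht₁⟩
    simp only at h1
    rw [dist_eq_norm] at hd₁ hd₂
    simp only [h1]
    change K * opNorm _ ≤ _ at hd₁
    change M * opNorm _ ≤ _ at hd₂
    linarith

end

/-- The complexity term of the generalization bound. -/
def complexityBound (A : Matrix (Fin n) (Fin N) ℝ) (τ B : ℝ) (L : ℕ) (x : Fin m → Vec N) : ℝ :=
  8 * B * √((N : ℝ) * n / m) * √(Real.log (Real.exp 1 *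
      (1 + 8 * constK A τ L (measurements A x) * opNorm A / (√(m : ℝ) * B))))
    + 8 * B * ((N : ℝ) / √(m : ℝ)) * √(Real.log (Real.exp 1 *
      (1 + 8 * constM A τ L (measurements A x) / (√(m : ℝ) * B))))

theorem rademacher_truncLoss_le (hm : 1 ≤ m) (A : Matrix (Fin n) (Fin N) ℝ) {τ lam B : ℝ} (c : ℝ)
    (hτ : 0 ≤ τ) (hlam : 0 ≤ lam) (hB : 0 < B) {L : ℕ} (hL : 1 ≤ L) (x : Fin m → Vec N)
    {ι : Type*} [Finite ι] [Nonempty ι] (θ : ι → Param N) :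
    2 * rademacher (fun i => sampleVec (truncLoss A τ lam B c L (θ i)) x)
      ≤ m * complexityBound A τ B L x := by
  have hm0 : (0 : ℝ) < m := by exact_mod_cast hm
  have hsm : 0 < √(m : ℝ) := Real.sqrt_pos.2 hm0
  set K := constK A τ L (measurements A x) with hK
  set M := constM A τ L (measurements A x) with hM
  have hK0 : 0 ≤ K := constK_nonneg A hτ hL _
  have hM0 : 0 ≤ M := constM_nonneg A hτ L _
  have hA0 := opNorm_nonneg A
  have hΔ : 0 < √(m : ℝ) * B := by positivity
  have h := rademacher_le_entropy
    (Set.range fun θ => sampleVec (truncLoss A τ lam B c L θ) x)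
    (sampleVec (fun a => min ‖(0 : Vec N) - a‖ c) x) hΔ
    -- At scale `ε = √m * B / 2 ^ (k + 1)` the net sizes take the form `1 + 2 ^ (k + 1) * u`. The
    -- entropy bound involves `2 * u`, hence the `8` inside the logarithms.
    (u₁ := 4 * (K * opNorm A) / (√(m : ℝ) * B)) (u₂ := 4 * M / (√(m : ℝ) * B))
    (by positivity) (by positivity) (N * n) (N * N)
    (by
      rintro _ ⟨θ, rfl⟩
      refine (norm_sampleVec_sub_le_of_le _ _ x fun j =>
        abs_truncLoss_sub_min_norm_le A τ lam c hB L θ (x j)).trans (le_of_eq ?_)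
      simp [Real.sqrt_mul, hB.le])
    (fun k => by
      obtain ⟨T, h1, h2, h3⟩ := exists_net_truncLoss A c hτ hlam hB hL x
        (ε := √(m : ℝ) * B / 2 ^ (k + 1)) (by positivity)
      refine ⟨T, h1, h2.trans (le_of_eq ?_), h3⟩
      rw [← hK, ← hM]
      congr 3 <;> field_simp)
    (fun i => sampleVec (truncLoss A τ lam B c L (θ i)) x) fun i => ⟨θ i, rfl⟩
  have e₁ : 2 * (4 * (K * opNorm A) / (√(m : ℝ) * B)) = 8 * K * opNorm A / (√(m : ℝ) * B) := by
    ring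
  have e₂ : 2 * (4 * M / (√(m : ℝ) * B)) = 8 * M / (√(m : ℝ) * B) := by ring
  rw [e₁, e₂] at h
  unfold complexityBound
  rw [← hK, ← hM]
  set l₁ := √(Real.log (Real.exp 1 * (1 + 8 * K * opNorm A / (√(m : ℝ) * B))))
  set l₂ := √(Real.log (Real.exp 1 * (1 + 8 * M / (√(m : ℝ) * B))))
  have hmm : (m : ℝ) = √(m : ℝ) * √(m : ℝ) := (Real.mul_self_sqrt hm0.le).symm
  have e₃ : √((N * N : ℕ) : ℝ) = N := by
    push_cast
    exact Real.sqrt_mul_self (by positivity)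
  have e₄ : √((N : ℝ) * n / m) = √((N * n : ℕ) : ℝ) / √(m : ℝ) := by
    push_cast
    exact Real.sqrt_div (by positivity) _
  have e₅ : (m : ℝ) * (8 * B * (√((N * n : ℕ) : ℝ) / √(m : ℝ)) * l₁ + 8 * B * (N / √(m : ℝ)) * l₂)
      = 8 * (√(m : ℝ) * B * (√((N * n : ℕ) : ℝ) * l₁ + N * l₂)) := by
    nth_rewrite 1 [hmm]
    field_simp
  rw [e₄, e₅]
  rw [e₃] at h
  -- Symmetrization and chaining give the factor `4 * √2`, rounded up to `8`.
  have h2 : √2 ≤ 2 := by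
    rw [Real.sqrt_le_left (by norm_num)]
    norm_num
  have h3 : 0 ≤ √(m : ℝ) * B * (√((N * n : ℕ) : ℝ) * l₁ + N * l₂) := by positivity
  have h4 := mul_le_mul_of_nonneg_right h2 h3
  linarith

/-- The deviation term makes the tail bound at most `δ`. -/
theorem exp_tail_le (hm : 1 ≤ m) {c δ : ℝ} (hc : 0 < c) (hδ0 : 0 < δ) (hδ1 : δ < 1) :
    Real.exp (-(m * (4 * c * √(2 * Real.log (4 / δ) / m))) ^ 2 / (2 * (m * (3 * c) ^ 2))) ≤ δ := by
  have hm0 : (0 : ℝ) < m := by exact_mod_cast hm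
  have hl : 0 < Real.log (4 / δ) := Real.log_pos (by rw [lt_div_iff₀ hδ0]; linarith)
  have hsq : √(2 * Real.log (4 / δ) / m) ^ 2 = 2 * Real.log (4 / δ) / m :=
    Real.sq_sqrt (by positivity)
  -- The ratio `16 / 9` comes from `4 ^ 2 * 2` over `2 * 3 ^ 2`. Being at least `1`, it leaves room
  -- to spare.
  have e : -(m * (4 * c * √(2 * Real.log (4 / δ) / m))) ^ 2 / (2 * (m * (3 * c) ^ 2))
      = -(16 / 9 * Real.log (4 / δ)) := by
    rw [mul_pow, mul_pow, hsq]
    field_simp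
    ring
  have h1 : Real.log (4 / δ) = Real.log 4 - Real.log δ := Real.log_div (by norm_num) hδ0.ne'
  have h2 : 0 < Real.log 4 := Real.log_pos (by norm_num)
  rw [e, ← Real.le_log_iff_exp_le hδ0]
  linarith

theorem secondCountableTopology_param (N : ℕ) : SecondCountableTopology (Param N) := by
  have : SecondCountableTopology (Matrix (Fin N) (Fin N) ℝ) :=
    inferInstanceAs (SecondCountableTopology (Fin N → Fin N → ℝ))
  exact TopologicalSpace.Subtype.secondCountableTopology _

/-- A failure of the generalization bound for finitely many parameters has probability at
most `δ`. -/
theorem measure_deviation_le (hm : 1 ≤ m) (A : Matrix (Fin n) (Fin N) ℝ) {τ lam B c δ : ℝ}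
    (hτ : 0 ≤ τ) (hlam : 0 ≤ lam) (hB : 0 < B) (hc : 0 < c) {L : ℕ} (hL : 1 ≤ L) (hδ0 : 0 < δ)
    (hδ1 : δ < 1) (D : Measure (Vec N)) [IsProbabilityMeasure D]
    {ι : Type*} [Finite ι] [Nonempty ι] (θ : ι → Param N) :
    (Measure.pi fun _ : Fin m => D) {x | ∃ i, complexityBound A τ B L x
        + 4 * c * √(2 * Real.log (4 / δ) / m) ≤ ∫ a, truncLoss A τ lam B c L (θ i) a ∂D
          - (1 / (m : ℝ)) * ∑ j, truncLoss A τ lam B c L (θ i) (x j)} ≤ ENNReal.ofReal δ := by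
  have hm0 : (0 : ℝ) < m := by exact_mod_cast hm
  have hmeas : ∀ i, Measurable (truncLoss A τ lam B c L (θ i)) := fun i =>
    (continuous_truncLoss_signal A c hτ hlam hB L (θ i)).measurable
  have h := measure_maxGap_ge_le (m := m) D hmeas
    (fun i a => truncLoss_nonneg A τ lam B hc.le L (θ i) a)
    (fun i a => truncLoss_le A τ lam B c L (θ i) a)
    (t := m * (4 * c * √(2 * Real.log (4 / δ) / m))) (by positivity)
  have h2 := (ENNReal.le_ofReal_iff_toReal_le (measure_ne_top _ _) hδ0.le).2
    (h.trans (exp_tail_le hm hc hδ0 hδ1))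
  refine (measure_mono ?_).trans h2
  rintro x ⟨i, hi⟩
  refine le_trans ?_ (le_iSup_of_finite _ i)
  refine (add_le_add_left
    (rademacher_truncLoss_le hm A c hτ hlam hB hL x θ) _).trans ?_
  have h3 := mul_le_mul_of_nonneg_left hi hm0.le
  rw [Finset.sum_sub_distrib, Finset.sum_const, Finset.card_univ, Fintype.card_fin, nsmul_eq_mul]
  rw [mul_add, mul_sub, ← mul_assoc (m : ℝ) (1 / (m : ℝ)), mul_one_div_cancel hm0.ne',
    one_mul] at h3
  exact h3

theorem continuous_integral_truncLoss (A : Matrix (Fin n) (Fin N) ℝ) {τ lam B c : ℝ}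
    (hτ : 0 ≤ τ) (hlam : 0 ≤ lam) (hB : 0 < B) (hc : 0 ≤ c) (L : ℕ) (D : Measure (Vec N))
    [IsProbabilityMeasure D] :
    Continuous fun θ : Param N => ∫ a, truncLoss A τ lam B c L θ a ∂D := by
  have := secondCountableTopology_param N
  refine continuous_of_dominated (bound := fun _ => c)
    (fun θ => (continuous_truncLoss_signal A c hτ hlam hB L θ).aestronglyMeasurable)
    (fun θ => Filter.Eventually.of_forall fun a => ?_) (integrable_const _)
    (Filter.Eventually.of_forall fun a =>
      continuous_truncLoss_param A c hτ hlam hB L a)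
  rw [Real.norm_of_nonneg (truncLoss_nonneg A τ lam B hc L θ a)]
  exact truncLoss_le A τ lam B c L θ a

/-- The generalization bound for the truncated loss, uniformly over all parameters. -/
theorem measure_compl_uniform_deviation_le (hm : 1 ≤ m) (A : Matrix (Fin n) (Fin N) ℝ)
    {τ lam B c δ : ℝ} (hτ : 0 ≤ τ) (hlam : 0 ≤ lam) (hB : 0 < B) (hc : 0 < c) {L : ℕ}
    (hL : 1 ≤ L) (hδ0 : 0 < δ) (hδ1 : δ < 1) (D : Measure (Vec N)) [IsProbabilityMeasure D] :
    (Measure.pi fun _ : Fin m => D) {x | ∀ θ : Param N, ∫ a, truncLoss A τ lam B c L θ a ∂D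
          - (1 / (m : ℝ)) * ∑ j, truncLoss A τ lam B c L θ (x j) ≤ complexityBound A τ B L x
            + 4 * c * √(2 * Real.log (4 / δ) / m)}ᶜ ≤ ENNReal.ofReal δ := by
  let dev : Param N → (Fin m → Vec N) → ℝ := fun θ x => ∫ a, truncLoss A τ lam B c L θ a ∂D
    - (1 / (m : ℝ)) * ∑ j, truncLoss A τ lam B c L θ (x j)
  let bd : (Fin m → Vec N) → ℝ := fun x => complexityBound A τ B L x
    + 4 * c * √(2 * Real.log (4 / δ) / m)
  have := secondCountableTopology_param N
  have : Nonempty (Param N) := ⟨⟨(1, 1), one_mem _, one_mem _⟩⟩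
  let u : ℕ → Param N := TopologicalSpace.denseSeq (Param N)
  -- Failure among the first `k + 1` terms of a dense sequence. These events increase and each has
  -- probability at most `δ`, so their union does too.
  let S : ℕ → Set (Fin m → Vec N) := fun k => {x | ∃ i : Fin (k + 1), bd x ≤ dev (u i) x}
  have hS : Monotone S := by
    rintro k k' hk x ⟨i, hi⟩
    exact ⟨⟨i, by omega⟩, hi⟩
  have hSδ : (Measure.pi fun _ : Fin m => D) (⋃ k, S k) ≤ ENNReal.ofReal δ := by
    rw [hS.measure_iUnion]
    exact iSup_le fun k => measure_deviation_le hm A hτ hlam hB hc hL hδ0 hδ1 D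
      fun i : Fin (k + 1) => u i
  refine (measure_mono ?_).trans hSδ
  rw [Set.compl_subset_comm]
  intro x hx θ
  have hdense : ∀ i, dev (u i) x ≤ bd x := fun i => by
    by_contra! hcon
    exact hx (Set.mem_iUnion.2 ⟨i, ⟨Fin.last i, hcon.le⟩⟩)
  have hcont : Continuous fun θ : Param N => dev θ x := by
    refine (continuous_integral_truncLoss A hτ hlam hB hc.le L D).sub
      (continuous_const.mul (continuous_finsetSum _ fun j _ => ?_))
    exact continuous_truncLoss_param A c hτ hlam hB L (x j)
  -- `bd x` does not depend on the parameter, so for fixed `x` the good parameters form a closed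
  -- set.
  exact isClosed_property (TopologicalSpace.denseRange_denseSeq (Param N))
    (isClosed_le hcont continuous_const) hdense θ

end Generalization

end LISTA

/-! ### The generalization bound -/

theorem mainTheorem2 {n N m L : ℕ} (hm : 1 ≤ m) (hL : 1 ≤ L)
    (A : Matrix (Fin n) (Fin N) ℝ) (τ lam Bin Bout δ : ℝ)
    (hτ : 0 < τ) (hlam : 0 < lam) (hBout : 0 < Bout) (hδ0 : 0 < δ) (hδ1 : δ < 1)
    (D : MeasureTheory.Measure (LISTA.Vec N)) [MeasureTheory.IsProbabilityMeasure D]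
    (hD : ∀ᵐ x ∂D, ‖x‖ ≤ Bin) :
    ENNReal.ofReal (1 - δ) ≤
      (MeasureTheory.Measure.pi fun _ : Fin m => D)
        {x | ∀ h ∈ LISTA.hypothesisClass A τ lam Bout L,
          LISTA.trueLoss A D h ≤ LISTA.empLoss A x h
            + 8 * Bout * √((N : ℝ) * n / m) *
                √(Real.log (Real.exp 1 *
                  (1 + 8 * LISTA.constK A τ L (LISTA.measurements A x) * LISTA.opNorm A /
                    (√(m : ℝ) * Bout))))
            + 8 * Bout * ((N : ℝ) / √(m : ℝ)) *
                √(Real.log (Real.exp 1 *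
                  (1 + 8 * LISTA.constM A τ L (LISTA.measurements A x) / (√(m : ℝ) * Bout))))
            + 4 * (Bin + Bout) * √(2 * Real.log (4 / δ) / m)} := by
  obtain ⟨x₀, hx₀⟩ := hD.exists
  have hBin : 0 ≤ Bin := (norm_nonneg x₀).trans hx₀
  set μ := MeasureTheory.Measure.pi fun _ : Fin m => D with hμ
  have hbad := LISTA.measure_compl_uniform_deviation_le hm A hτ.le hlam.le hBout
    (add_pos_of_nonneg_of_pos hBin hBout) hL hδ0 hδ1 D
  set G := {x : Fin m → LISTA.Vec N | ∀ θ : LISTA.Param N,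
    ∫ a, LISTA.truncLoss A τ lam Bout (Bin + Bout) L θ a ∂D
      - (1 / (m : ℝ)) * ∑ j, LISTA.truncLoss A τ lam Bout (Bin + Bout) L θ (x j)
      ≤ LISTA.complexityBound A τ Bout L x + 4 * (Bin + Bout) * √(2 * Real.log (4 / δ) / m)}
    with hG
  have hsamp : ∀ᵐ x ∂μ, ∀ j, ‖x j‖ ≤ Bin := by
    rw [MeasureTheory.ae_all_iff]
    intro j
    exact (MeasureTheory.measurePreserving_eval (fun _ : Fin m => D) j).quasiMeasurePreserving.ae hD
  have hone : ENNReal.ofReal (1 - δ) ≤ μ G := by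
    -- Subadditivity alone passes from the complement to `G`, so `G` need not be shown measurable.
    have h1 : (1 : ENNReal) ≤ μ G + ENNReal.ofReal δ := by
      calc (1 : ENNReal) = μ Set.univ := MeasureTheory.measure_univ.symm
        _ = μ (G ∪ Gᶜ) := by rw [Set.union_compl_self]
        _ ≤ μ G + μ Gᶜ := MeasureTheory.measure_union_le _ _
        _ ≤ μ G + ENNReal.ofReal δ := by gcongr
    rw [ENNReal.ofReal_sub _ hδ0.le, ENNReal.ofReal_one]
    exact tsub_le_iff_right.2 h1
  -- Inclusion is needed only for almost every sample, namely where all `‖x j‖ ≤ Bin` and truncation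
  -- is inactive.
  refine hone.trans (MeasureTheory.measure_mono_ae ?_)
  filter_upwards [hsamp] with x hx hxG
  rintro h ⟨Ψ, hΨ, Φ, hΦ, rfl⟩
  have key := hxG ⟨(Ψ, Φ), hΨ, hΦ⟩
  have htrue : ∫ a, LISTA.truncLoss A τ lam Bout (Bin + Bout) L ⟨(Ψ, Φ), hΨ, hΦ⟩ a ∂D
      = LISTA.trueLoss A D fun y => LISTA.clip Bout (LISTA.mulE Ψ (LISTA.network A τ lam Φ L y)) :=
    MeasureTheory.integral_congr_ae (hD.mono fun a ha => LISTA.truncLoss_eq A hBout L _ ha)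
  have hemp : (1 / (m : ℝ)) * ∑ j, LISTA.truncLoss A τ lam Bout (Bin + Bout) L
        ⟨(Ψ, Φ), hΨ, hΦ⟩ (x j)
      = LISTA.empLoss A x fun y => LISTA.clip Bout
          (LISTA.mulE Ψ (LISTA.network A τ lam Φ L y)) := by
    rw [LISTA.empLoss]
    congr 1
    exact Finset.sum_congr rfl fun j _ => LISTA.truncLoss_eq A hBout L _ (hx j)
  rw [htrue, hemp, LISTA.complexityBound] at key
  linarith
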